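/- Conventions. Permutations and transformations of $\{1,\dots,n\}$ act on the right and are composed from left to right ($fg$ means first $f$, then $g$). $S_n$ and $T_n$ are the symmetric group and the full transformation monoid on $\{1,\dots,n\}$, and the rank of $f\in T_n$ is the size of its image. A monoid presentation $\langle A\mid R\rangle$, where $R\subseteq A^*\times A^*$, defines the monoid $M$ (via $\varphi$) if $\varphi:A^*\to M$ is a surjective homomorphism whose kernel is the least congruence on $A^*$ containing $R$; a word $w$ then represents the element $\varphi(w)$, and the rank of a relation in a presentation of $T_n$ is the rank of the transformation represented by its two sides. A relation in a presentation of $T_n$ is a non-$S_n$ relation if its sides do not represent permutations. Theorem. (1) Let $n\ge 7$ and let $\langle A\mid R\rangle$ be any monoid presentation defining $S_n$. Let $\zeta\notin A$ be a new letter. Then $T_n$ is defined by the presentation with generators $A\cup\{\zeta\}$, and with relations $R$ together with the following four relations: (T7) $(1,n)(2,3)\,\zeta\,(1,n)(2,3)\,\zeta=\zeta\,(1,n)(2,3)\,\zeta\,(1,n)(2,3)$; (T8) $(2,3)\,\zeta\,(2,3)\,\zeta\,(2,3)\,\zeta\,(2,3)=\zeta\,(2,3)\,\zeta$; (T$\alpha$)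 $\alpha^{-1}\zeta\alpha=\zeta\,(1,3)\,\zeta\,(1,3)$; (T$\beta$) $\beta^{-1}\zeta\beta=(1,2)\,\zeta\,(1,3)\,\zeta\,(1,3)$; where $\alpha=(3,4)$ and $\beta=(3,4,\dots,n)$ if $n$ is odd, and $\alpha=(3,4,\dots,n)$ and $\beta=(3,7,6,4,5)$ if $n$ is even. Here each permutation, including $\alpha^{\pm1}$ and $\beta^{\pm1}$, stands for any word in $A^*$ representing it; in $T_n$ the letters of $A$ represent the same permutations as in $S_n$, and $\zeta$ represents the idempotent of rank $n-1$ that maps $2$ to $1$ and fixes every other point. (2) Let $n\ge 4$. Every monoid presentation defining $T_n$ contains at least four non-$S_n$ relations, and at least two of its non-$S_n$ relations have rank $n-2$. In particular, if $\langle A\mid R\rangle$ is a monoid presentation defining $S_n$ and $\langle A\cup B\mid R\cup S\rangle$, with $A\cap B=\varnothing$, is a monoid presentation defining $T_n$, then $|S|\ge 4$ and $S$ contains at least two relations of rank $n-2$. -/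

import Mathlib

/-- `⟨A | R⟩` is a monoid presentation defining `M`, where the word `w` represents the element
`φ w` of `M`: the homomorphism `φ` from the free monoid is surjective and its kernel is the least
congruence containing `R`. -/
def IsMonoidPresentation {A M : Type*} [Monoid M] (R : Set (FreeMonoid A × FreeMonoid A))
    (φ : FreeMonoid A →* M) : Prop :=
  Function.Surjective φ ∧ Con.ker φ = conGen (fun u v => (u, v) ∈ R)

/-- The full transformation monoid on `n` points. Transformations act on the right, so that
`f * g` means first `f` and then `g`; this is the opposite of Mathlib's `Function.End`. -/
abbrev FullTransf (n : ℕ) : Type := (Function.End (Fin n))ᵐᵒᵖ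

/-- The symmetric group on `n` points, with permutations acting on the right. -/
abbrev SymGroup (n : ℕ) : Type := (Equiv.Perm (Fin n))ᵐᵒᵖ

/-- The inclusion of the symmetric group in the full transformation monoid. -/
def symInclusion (n : ℕ) : SymGroup n →* FullTransf n :=
  MonoidHom.op (MulAction.toEndHom : Equiv.Perm (Fin n) →* Function.End (Fin n))

/-- The rank of a transformation is the size of its image. -/
noncomputable def transfRank {n : ℕ} (f : FullTransf n) : ℕ :=
  (Set.range (f.unop : Fin n → Fin n)).ncard

/-- The point `k` of `{1, …, n}`, as an element of `Fin n` (whose first element is `0`). -/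
def pt (n k : ℕ) (h : 1 ≤ k ∧ k ≤ n := by omega) : Fin n := ⟨k - 1, by omega⟩

/-- The idempotent of rank `n - 1` that maps the point `2` to the point `1`. -/
def zetaTransf (n : ℕ) : FullTransf n :=
  MulOpposite.op (fun x : Fin n => if x.val = 1 then ⟨0, x.pos⟩ else x)

/-- The cycle `(3, 4, …, n)`. -/
def longCycle (n : ℕ) : Equiv.Perm (Fin n) := ((List.finRange n).drop 2).formPerm

/-- The permutation `α`: it is `(3, 4)` if `n` is odd, and `(3, 4, …, n)` if `n` is even. -/
def alphaPerm (n : ℕ) (hn : 7 ≤ n) : Equiv.Perm (Fin n) :=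
  if Odd n then Equiv.swap (pt n 3) (pt n 4) else longCycle n

/-- The permutation `β`: it is `(3, 4, …, n)` if `n` is odd, and `(3, 7, 6, 4, 5)` if `n` is
even. -/
def betaPerm (n : ℕ) (hn : 7 ≤ n) : Equiv.Perm (Fin n) :=
  if Odd n then longCycle n
  else [pt n 3, pt n 7, pt n 6, pt n 4, pt n 5].formPerm

/-- The four additional relations over the alphabet `A ∪ {ζ}`, where `w σ` is the chosen word
over `A` representing the permutation `σ`, and the new letter `ζ` is `Sum.inr ()`. -/
def extraRelations {A : Type*} (n : ℕ) (hn : 7 ≤ n) (w : Equiv.Perm (Fin n) → FreeMonoid A) :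
    Set (FreeMonoid (A ⊕ Unit) × FreeMonoid (A ⊕ Unit)) :=
  let p : Equiv.Perm (Fin n) → FreeMonoid (A ⊕ Unit) := fun σ => FreeMonoid.map Sum.inl (w σ)
  let ζ : FreeMonoid (A ⊕ Unit) := FreeMonoid.of (Sum.inr ())
  let c : FreeMonoid (A ⊕ Unit) :=
    p (Equiv.swap (pt n 1) (pt n n) * Equiv.swap (pt n 2) (pt n 3))
  let s12 : FreeMonoid (A ⊕ Unit) := p (Equiv.swap (pt n 1) (pt n 2))
  let s13 : FreeMonoid (A ⊕ Unit) := p (Equiv.swap (pt n 1) (pt n 3))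
  let s23 : FreeMonoid (A ⊕ Unit) := p (Equiv.swap (pt n 2) (pt n 3))
  let α := alphaPerm n hn
  let β := betaPerm n hn
  {(c * ζ * c * ζ, ζ * c * ζ * c),
   (s23 * ζ * s23 * ζ * s23 * ζ * s23, ζ * s23 * ζ),
   (p α⁻¹ * ζ * p α, ζ * s13 * ζ * s13),
   (p β⁻¹ * ζ * p β, s12 * ζ * s13 * ζ * s13)}

/-- Relations over `A`, read as relations over a larger alphabet `A ∪ B`. -/
def liftRelations {A : Type*} (B : Type*) (R : Set (FreeMonoid A × FreeMonoid A)) :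
    Set (FreeMonoid (A ⊕ B) × FreeMonoid (A ⊕ B)) :=
  (fun r => (FreeMonoid.map Sum.inl r.1, FreeMonoid.map Sum.inl r.2)) '' R

/-- The homomorphism from `(A ∪ {ζ})*` to the full transformation monoid under which every letter
of `A` represents the permutation that it represents under `φ`, and `ζ` represents the idempotent
`zetaTransf n`. -/
def extendByZeta {A : Type*} {n : ℕ} (φ : FreeMonoid A →* SymGroup n) :
    FreeMonoid (A ⊕ Unit) →* FullTransf n :=
  FreeMonoid.lift
    (Sum.elim (fun a => symInclusion n (φ (FreeMonoid.of a))) (fun _ => zetaTransf n))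

/-- The relations of a presentation of the full transformation monoid whose two sides do not
represent permutations. -/
def nonSymRelations {X : Type*} {n : ℕ} (Q : Set (FreeMonoid X × FreeMonoid X))
    (ψ : FreeMonoid X →* FullTransf n) : Set (FreeMonoid X × FreeMonoid X) :=
  {r ∈ Q | ψ r.1 ∉ MonoidHom.mrange (symInclusion n)}

/-!
The presentation. Let `N` be the monoid defined by the relations, read from right to left, so that
products correspond to composition of maps; let `e` be the image of `ζ`, let `t = (1,2)`, and let
`f` be the conjugate of `e` by `(1,3)`. The relations for `α` and `β` say that conjugation by `α`
maps `e` to `f e`, and conjugation by `β` maps it to `f e t`. Both permutations fix the points 1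
and 2, so `α⁻¹β` maps `e` to `e t`, and its square fixes `e`. The cycle types of `α` and `β` are
such that the permutations known to fix `e`, or to map it to `e t`, generate enough to conclude
that every transposition of points other than 1 and 2 maps `e` to `e t`, and that `f e = e t`
(`star_of_relations_odd`, `star_of_relations_even`). Comparing a few conjugates of the latter
equation yields `e t = e` (`mul_swap_eq_self`), hence also `f e = e`. So `e` is fixed by all
permutations that fix 1 and 2, and its conjugates can be indexed by pairs of points. The cubic
relation between `ζ` and `(2,3)` makes collapses onto a common point commute, and the relation for
`(1,n)(2,3)` does so for collapses of disjoint pairs of points (`collapseSystem_orbitCollapse`).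

From these relations every element of `N` gets a normal form `g π * E`, where `E` is a product of
collapses that depends only on the kernel of the represented transformation, and `g π * E` depends
only on that transformation (`CollapseSystem.Represents.unique`). The normal forms are closed
under left multiplication by the generators, so a word is determined in `N` by the transformation
that it represents (`eq_of_extendByZeta_eq`).

The lower bounds. A quantity attached to words that is preserved by each single application of a
relation agrees on any two words representing the same transformation
(`invariant_of_presentation`). For rank `n - 2` this quantity is the kernel of the first prefix
that does not represent a permutation. It changes between `e f` and `f e` for commuting
idempotents `e`, `f` of rank `n - 1`, and only a relation of rank `n - 2` with the kernel type of
`e f` can change it; the two possible kernel types give two relations. For rank `n - 1` it is the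
sign of the permutations in the word together with the number of other letters, in an abelian
group modulo a single element if there is a single relation of rank `n - 1`; the equations `e² =
e` and `(1,2) e = e` cannot both be reflected in such a quotient.
-/

/-! ### Normal forms from the relations between collapses -/

open Equiv in
/-- A monoid `N` with a homomorphism `g` from the symmetric group and elements `E i j` satisfying
the relations of the transformations that map `j` to `i` and fix every other point. Products are
read as for composition of maps: the right-hand factor comes first. The degenerate `E i i` is `1`,
so that products of collapses may range over all points. -/
structure CollapseSystem {Ω N : Type*} [DecidableEq Ω] [Monoid N] (g : Perm Ω →* N)
    (E : Ω → Ω → N) : Prop where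
  diag : ∀ i, E i i = 1
  conj : ∀ σ i j, g σ * E i j = E (σ i) (σ j) * g σ
  mul_swap : ∀ i j, i ≠ j → E i j * g (swap i j) = E i j
  absorb : ∀ a b c, a ≠ b → c ≠ b → E a b * E c b = E c b
  comm_target : ∀ a b c, a ≠ b → a ≠ c → b ≠ c → E a b * E a c = E a c * E a b
  comm_disjoint : ∀ a b c d, a ≠ b → a ≠ c → a ≠ d → b ≠ c → b ≠ d → c ≠ d →
    E a b * E c d = E c d * E a b

/-- The representative of the class of `x` in the kernel of `t`: the least point with the same
image. -/
def kerRep {Ω : Type*} [Fintype Ω] [LinearOrder Ω] (t : Ω → Ω) (x : Ω) : Ω :=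
  (Finset.univ.filter (fun y => t y = t x)).min' ⟨x, by simp⟩

section kerRep

variable {Ω : Type*} [Fintype Ω] [LinearOrder Ω] (t : Ω → Ω)

lemma map_kerRep (x : Ω) : t (kerRep t x) = t x :=
  (Finset.mem_filter.1 (Finset.min'_mem (Finset.univ.filter (fun y => t y = t x)) _)).2

lemma kerRep_le {x y : Ω} (h : t y = t x) : kerRep t x ≤ y :=
  Finset.min'_le _ _ (by simpa using h)

lemma kerRep_eq_of_le {x y : Ω} (h : t y = t x) (hy : ∀ z, t z = t x → y ≤ z) :
    kerRep t x = y :=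
  le_antisymm (kerRep_le t h) (hy _ (map_kerRep t x))

lemma kerRep_eq_iff {x y : Ω} : kerRep t x = kerRep t y ↔ t x = t y := by
  constructor
  · intro h
    rw [← map_kerRep t x, h, map_kerRep t y]
  · intro h
    exact kerRep_eq_of_le t ((map_kerRep t y).trans h.symm)
      fun z hz => kerRep_le t (hz.trans h)

lemma kerRep_kerRep (x : Ω) : kerRep t (kerRep t x) = kerRep t x :=
  (kerRep_eq_iff t).2 (map_kerRep t x)

lemma kerRep_congr {s t : Ω → Ω} (h : ∀ x y, s x = s y ↔ t x = t y) : kerRep s = kerRep t := by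
  funext x
  exact kerRep_eq_of_le s ((h _ _).2 (map_kerRep t x)) fun z hz => kerRep_le t ((h _ _).1 hz)

end kerRep

namespace CollapseSystem

open Equiv Finset

variable {Ω N : Type*} [Monoid N]

section basic

variable [DecidableEq Ω] {g : Perm Ω →* N} {E : Ω → Ω → N}

lemma g_swap_mul_self (g : Perm Ω →* N) (a b : Ω) : g (swap a b) * g (swap a b) = 1 := by
  rw [← map_mul, swap_mul_self, map_one]

lemma swap_mul (S : CollapseSystem g E) {a b : Ω} (h : a ≠ b) :
    g (swap a b) * E a b = E b a := by
  rw [S.conj, swap_apply_left, swap_apply_right, swap_comm, S.mul_swap _ _ h.symm]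

lemma shift (S : CollapseSystem g E) {i j k : Ω} (hij : i ≠ j) (hjk : j ≠ k) :
    E j k * E i j = g (swap j k) * E i j := by
  rw [← S.mul_swap j k hjk, mul_assoc, S.conj, swap_apply_left, ← mul_assoc]
  refine congrArg (· * _) (S.absorb _ _ _ hjk ?_)
  intro h
  rw [swap_apply_eq_iff, swap_apply_right] at h
  exact hij h

/-- Once `b` has been merged into `a`, merging `x` into `b` or into `a` makes no difference. -/
lemma merge (S : CollapseSystem g E) {a b x : Ω} (hab : a ≠ b) (hax : a ≠ x) (hbx : b ≠ x) :
    E a b * E b x = E a b * E a x := by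
  conv_lhs => rw [← S.mul_swap a b hab, mul_assoc, S.conj, swap_apply_right,
    swap_apply_of_ne_of_ne hax.symm hbx.symm, ← mul_assoc, S.comm_target a b x hab hax hbx,
    mul_assoc, S.mul_swap a b hab]
  exact S.comm_target a x b hax hab hbx.symm

lemma commute_of_idem (S : CollapseSystem g E) {ρ : Ω → Ω} (hρ : ∀ x, ρ (ρ x) = ρ x)
    {x y : Ω} (hxy : x ≠ y) : Commute (E (ρ x) x) (E (ρ y) y) := by
  by_cases hx : ρ x = x
  · rw [hx, S.diag]; exact Commute.one_left _
  by_cases hy : ρ y = y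
  · rw [hy, S.diag]; exact Commute.one_right _
  have h1 : ρ x ≠ y := fun h => hy (by rw [← h, hρ])
  have h2 : ρ y ≠ x := fun h => hx (by rw [← h, hρ])
  by_cases h : ρ x = ρ y
  · rw [← h]
    exact S.comm_target _ _ _ hx h1 hxy
  · exact S.comm_disjoint _ _ _ _ hx h h1 h2.symm hxy hy

lemma pairwise_commute (S : CollapseSystem g E) {ρ : Ω → Ω} (hρ : ∀ x, ρ (ρ x) = ρ x)
    (s : Finset Ω) : (s : Set Ω).Pairwise (Function.onFun Commute fun x => E (ρ x) x) :=
  fun _ _ _ _ h => S.commute_of_idem hρ h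

end basic

variable [Fintype Ω] [LinearOrder Ω] {g : Perm Ω →* N} {E : Ω → Ω → N}

/-- The product of the collapses of each point `x` onto `ρ x`; for idempotent `ρ` it represents
the transformation `ρ`. -/
def collapseProd (S : CollapseSystem g E) (ρ : Ω → Ω) (hρ : ∀ x, ρ (ρ x) = ρ x) : N :=
  univ.noncommProd (fun x => E (ρ x) x) (S.pairwise_commute hρ univ)

lemma exists_collapseProd_eq (S : CollapseSystem g E) (ρ : Ω → Ω) (hρ : ∀ x, ρ (ρ x) = ρ x)
    (b : Ω) : ∃ m, S.collapseProd ρ hρ = E (ρ b) b * m :=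
  ⟨_, (mul_noncommProd_erase univ (mem_univ b) _ _).symm⟩

/-- Collapsing a point that is not in the image of `ρ` has no effect after `ρ`. -/
lemma collapse_mul_of_not_fixed (S : CollapseSystem g E) {ρ : Ω → Ω}
    (hρ : ∀ x, ρ (ρ x) = ρ x) {a b : Ω} (hab : a ≠ b) (hb : ρ b ≠ b) :
    E a b * S.collapseProd ρ hρ = S.collapseProd ρ hρ := by
  obtain ⟨m, hm⟩ := S.exists_collapseProd_eq ρ hρ b
  rw [hm, ← mul_assoc, S.absorb _ _ _ hab hb]

/-- Collapsing onto a point `a` outside the image of `ρ` amounts, after `ρ`, to a transposition. -/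
lemma collapse_mul_of_target_not_fixed (S : CollapseSystem g E) {ρ : Ω → Ω}
    (hρ : ∀ x, ρ (ρ x) = ρ x) {a b : Ω} (hab : a ≠ b) (ha : ρ a ≠ a) :
    E a b * S.collapseProd ρ hρ = g (swap a b) * S.collapseProd ρ hρ := by
  obtain ⟨m, hm⟩ := S.exists_collapseProd_eq ρ hρ a
  rw [hm, ← mul_assoc, S.shift ha hab, mul_assoc]

lemma swap_mul_of_not_fixed (S : CollapseSystem g E) {ρ : Ω → Ω}
    (hρ : ∀ x, ρ (ρ x) = ρ x) {a b : Ω} (ha : ρ a ≠ a) (hb : ρ b ≠ b) :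
    g (swap a b) * S.collapseProd ρ hρ = S.collapseProd ρ hρ := by
  by_cases hab : a = b
  · rw [hab, swap_self]
    exact (congrArg (· * _) (map_one g)).trans (one_mul _)
  · rw [← S.collapse_mul_of_target_not_fixed hρ hab ha, S.collapse_mul_of_not_fixed hρ hab hb]

lemma perm_mul_of_fixes (S : CollapseSystem g E) {ρ : Ω → Ω}
    (hρ : ∀ x, ρ (ρ x) = ρ x) (σ : Perm Ω) (hσ : ∀ x, ρ x = x → σ x = x) :
    g σ * S.collapseProd ρ hρ = S.collapseProd ρ hρ := by
  have key : ∀ τ : Perm {x // ρ x ≠ x},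
      g (Perm.ofSubtype τ) * S.collapseProd ρ hρ = S.collapseProd ρ hρ := by
    intro τ
    induction τ using Perm.swap_induction_on with
    | one => rw [map_one, map_one, one_mul]
    | swap_mul τ x y _ ih =>
      rw [map_mul, Perm.ofSubtype_swap_eq, map_mul, mul_assoc, ih,
        S.swap_mul_of_not_fixed hρ x.2 y.2]
  have hmem : ∀ x, σ x ≠ x → ρ x ≠ x := fun x h h' => h (hσ x h')
  have hinv : ∀ x, ρ (σ x) ≠ σ x ↔ ρ x ≠ x := by
    intro x
    by_cases hx : σ x = x
    · rw [hx]
    · refine ⟨fun _ => hmem x hx, fun _ => hmem _ fun h => hx (σ.injective h)⟩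
  have := key (σ.subtypePerm hinv)
  rwa [Perm.ofSubtype_subtypePerm _ hmem] at this

/-- After `ρ`, collapsing one point `b` of the image onto another point `a` of the image merges
the two kernel classes, with representative `a`. -/
lemma collapse_mul_of_fixed (S : CollapseSystem g E) {ρ : Ω → Ω}
    (hρ : ∀ x, ρ (ρ x) = ρ x) {a b : Ω} (hab : a ≠ b) (ha : ρ a = a) (hb : ρ b = b)
    (ρ' : Ω → Ω) (hρ' : ∀ x, ρ' (ρ' x) = ρ' x) (h : ∀ x, ρ' x = if ρ x = b then a else ρ x) :
    E a b * S.collapseProd ρ hρ = S.collapseProd ρ' hρ' := by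
  have hb' : ρ' b = a := by rw [h, if_pos hb]
  have key : ∀ s : Finset Ω, b ∉ s →
      E a b * s.noncommProd (fun x => E (ρ x) x)
        (S.pairwise_commute hρ s) =
      E a b * s.noncommProd (fun x => E (ρ' x) x)
        (S.pairwise_commute hρ' s) := by
    intro s
    induction s using Finset.induction_on with
    | empty => intro _; rfl
    | insert x s hx ih =>
      intro hbs
      rw [mem_insert, not_or] at hbs
      rw [noncommProd_insert_of_notMem _ _ _ _ hx, noncommProd_insert_of_notMem _ _ _ _ hx]
      have hc := S.commute_of_idem hρ' hbs.1
      rw [hb'] at hc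
      have h1 : E a b * E (ρ x) x = E a b * E (ρ' x) x := by
        by_cases hx' : ρ x = b
        · have hax : a ≠ x := by
            rintro rfl
            exact hab (ha.symm.trans hx')
          rw [h x, if_pos hx', hx', S.merge hab hax hbs.1]
        · rw [h x, if_neg hx']
      rw [← mul_assoc, h1, hc.eq, mul_assoc, ih hbs.2, ← mul_assoc, ← hc.eq, mul_assoc]
  unfold collapseProd
  rw [← mul_noncommProd_erase univ (mem_univ b) (fun x => E (ρ x) x),
    ← mul_noncommProd_erase univ (mem_univ b) (fun x => E (ρ' x) x), hb, hb', S.diag, one_mul]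
  exact key _ (notMem_erase b univ)

/-- The element `m` is the normal form of the transformation `t`: a permutation after the product
of the collapses of every point onto its representative. -/
def Represents (S : CollapseSystem g E) (t : Ω → Ω) (m : N) : Prop :=
  ∃ π : Perm Ω, (∀ x, t x = π (kerRep t x)) ∧
    m = g π * S.collapseProd (kerRep t) (kerRep_kerRep t)

lemma Represents.unique {S : CollapseSystem g E} {t : Ω → Ω} {m m' : N}
    (h : S.Represents t m) (h' : S.Represents t m') : m = m' := by
  obtain ⟨π, hπ, rfl⟩ := h
  obtain ⟨π', hπ', rfl⟩ := h'
  have := S.perm_mul_of_fixes (kerRep_kerRep t) (π⁻¹ * π') fun x hx => by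
    rw [Perm.mul_apply, Perm.inv_eq_iff_eq]
    have h1 := hπ x
    have h2 := hπ' x
    rw [hx] at h1 h2
    rw [← h1, ← h2]
  rw [← this, ← mul_assoc, ← map_mul, mul_inv_cancel_left, this]

lemma represents_one (S : CollapseSystem g E) : S.Represents id 1 := by
  have hid : ∀ x : Ω, kerRep id x = x := fun x => map_kerRep id x
  refine ⟨1, fun x => (hid x).symm, ?_⟩
  rw [map_one, one_mul]
  refine ((Finset.noncommProd_eq_pow_card _ _ _ 1 fun x _ => ?_).trans (one_pow _)).symm
  rw [hid, S.diag]

lemma Represents.perm_mul {S : CollapseSystem g E} {t : Ω → Ω} {m : N}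
    (h : S.Represents t m) (σ : Perm Ω) : S.Represents (σ ∘ t) (g σ * m) := by
  obtain ⟨π, hπ, rfl⟩ := h
  have hk : kerRep (σ ∘ t) = kerRep t := kerRep_congr fun x y => σ.injective.eq_iff
  refine ⟨σ * π, fun x => ?_, ?_⟩
  · rw [hk, Perm.mul_apply, ← hπ]; rfl
  · rw [map_mul, mul_assoc]
    simp only [hk]

lemma Represents.collapse_mul_of_lt (S : CollapseSystem g E) {t : Ω → Ω} {π : Perm Ω}
    (hπ : ∀ x, t x = π (kerRep t x)) {a b : Ω} (hab : a < b) (ha : kerRep t a = a)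
    (hb : kerRep t b = b) :
    S.Represents (fun x => if t x = π b then π a else t x)
      (E (π a) (π b) * (g π * S.collapseProd (kerRep t) (kerRep_kerRep t))) := by
  have hij : π a ≠ π b := π.injective.ne hab.ne
  have htb : ∀ x, t x = π b ↔ kerRep t x = b := fun x => by rw [hπ, π.injective.eq_iff]
  have hta : ∀ x, t x = π a ↔ kerRep t x = a := fun x => by rw [hπ, π.injective.eq_iff]
  have hk : ∀ x, kerRep (fun x => if t x = π b then π a else t x) x =
      if kerRep t x = b then a else kerRep t x := by
    intro x
    have h1 := fun y => @kerRep_le _ _ _ t x y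
    have h2 := fun y => @kerRep_le _ _ _ t a y
    have h3 := fun y => @kerRep_le _ _ _ t b y
    have h4 := map_kerRep t x
    have h5 := (hta a).2 ha
    have h6 := (htb b).2 hb
    have h7 := htb x
    have h8 := hta x
    refine kerRep_eq_of_le _ (by grind) fun z hz => ?_
    have h9 := htb z
    by_cases hx : kerRep t x = b
    · rw [if_pos hx]
      by_cases hzb : t z = π b
      · exact hab.le.trans (hb.symm.trans_le (h3 z (by rw [hzb, h6])))
      · exact ha.symm.trans_le (h2 z (by grind))
    · rw [if_neg hx]
      by_cases hzb : t z = π b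
      · have hxa : kerRep t x = a := by grind
        rw [hxa]
        exact hab.le.trans (hb.symm.trans_le (h3 z (by rw [hzb, h6])))
      · exact h1 z (by grind)
  refine ⟨π, fun x => ?_, ?_⟩
  · rw [hk]
    have := htb x
    have := hπ x
    grind
  · rw [← mul_assoc, ← S.conj, mul_assoc,
      S.collapse_mul_of_fixed _ hab.ne ha hb _ (kerRep_kerRep _) hk]

lemma Represents.collapse_mul {S : CollapseSystem g E} {t : Ω → Ω} {m : N}
    (h : S.Represents t m) {i j : Ω} (hij : i ≠ j) :
    S.Represents (fun x => if t x = j then i else t x) (E i j * m) := by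
  obtain ⟨π, hπ, rfl⟩ := h
  obtain ⟨a, rfl⟩ := π.surjective i
  obtain ⟨b, rfl⟩ := π.surjective j
  have hab : a ≠ b := fun h => hij (by rw [h])
  have htb : ∀ x, t x = π b → kerRep t b = b := fun x h => by
    rw [hπ, π.injective.eq_iff] at h
    rw [← h, kerRep_kerRep]
  have hta : ∀ x, t x = π a → kerRep t a = a := fun x h => by
    rw [hπ, π.injective.eq_iff] at h
    rw [← h, kerRep_kerRep]
  by_cases hb : kerRep t b = b
  swap
  · have : (fun x => if t x = π b then π a else t x) = t := by
      funext x
      exact if_neg fun h => hb (htb x h)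
    rw [this, ← mul_assoc, ← S.conj, mul_assoc, S.collapse_mul_of_not_fixed _ hab hb]
    exact ⟨π, hπ, rfl⟩
  by_cases ha : kerRep t a = a
  swap
  · have hna : ∀ x, t x ≠ π a := fun x h => ha (hta x h)
    have hk : kerRep (fun x => if t x = π b then π a else t x) = kerRep t := by
      refine kerRep_congr fun x y => ?_
      have := hna x
      have := hna y
      grind
    refine ⟨π * swap a b, fun x => ?_, ?_⟩
    · rw [hk, Perm.mul_apply]
      have h1 := hπ x
      have h2 := hna x
      rw [h1, π.injective.ne_iff] at h2
      simp only [h1, π.injective.eq_iff]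
      split_ifs with hx
      · rw [hx, swap_apply_right]
      · rw [swap_apply_of_ne_of_ne h2 hx]
    · simp only [hk]
      rw [← mul_assoc, ← S.conj, mul_assoc, S.collapse_mul_of_target_not_fixed _ hab ha, map_mul,
        mul_assoc]
  rcases lt_or_gt_of_ne hab with hlt | hlt
  · exact Represents.collapse_mul_of_lt S hπ hlt ha hb
  · have := (Represents.collapse_mul_of_lt S hπ hlt hb ha).perm_mul (swap (π b) (π a))
    rw [← mul_assoc, S.swap_mul hij.symm] at this
    convert this using 2 with x
    have := hij
    simp only [Function.comp_apply, swap_apply_def]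
    grind

end CollapseSystem

/-! ### From one collapse to all collapses -/

section conjBy

open Equiv

variable {Ω N : Type*} [Monoid N] (g : Perm Ω →* N)

/-- Conjugation of the elements of `N` by (the image in `N` of) a permutation. -/
def conjBy (σ : Perm Ω) : N →* N where
  toFun x := g σ * x * g σ⁻¹
  map_one' := by rw [mul_one, ← map_mul, mul_inv_cancel, map_one]
  map_mul' x y := by
    have h : g σ⁻¹ * g σ = 1 := by rw [← map_mul, inv_mul_cancel, map_one]
    calc g σ * (x * y) * g σ⁻¹ = g σ * x * 1 * y * g σ⁻¹ := by simp only [mul_assoc, one_mul]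
      _ = g σ * x * g σ⁻¹ * (g σ * y * g σ⁻¹) := by rw [← h]; simp only [mul_assoc]

lemma conjBy_apply (σ : Perm Ω) (x : N) : conjBy g σ x = g σ * x * g σ⁻¹ := rfl

lemma conjBy_mul (σ τ : Perm Ω) (x : N) : conjBy g (σ * τ) x = conjBy g σ (conjBy g τ x) := by
  simp only [conjBy_apply, mul_inv_rev, map_mul g, mul_assoc]

lemma conjBy_one (x : N) : conjBy g 1 x = x := by
  rw [conjBy_apply, inv_one, map_one, one_mul, mul_one]

lemma conjBy_perm (σ τ : Perm Ω) : conjBy g σ (g τ) = g (σ * τ * σ⁻¹) := by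
  rw [conjBy_apply, map_mul, map_mul]

lemma mul_conjBy (σ : Perm Ω) (x : N) : g σ * x = conjBy g σ x * g σ := by
  rw [conjBy_apply, mul_assoc, ← map_mul, inv_mul_cancel, map_one, mul_one]

lemma conjBy_eq_iff {σ : Perm Ω} {x y : N} : conjBy g σ x = y ↔ x = conjBy g σ⁻¹ y := by
  constructor
  · rintro rfl
    rw [← conjBy_mul, inv_mul_cancel, conjBy_one]
  · rintro rfl
    rw [← conjBy_mul, mul_inv_cancel, conjBy_one]

lemma conjBy_swap [DecidableEq Ω] (a b : Ω) (x : N) :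
    conjBy g (swap a b) x = g (swap a b) * x * g (swap a b) := by
  rw [conjBy_apply, swap_inv]

end conjBy

lemma exists_perm_apply_eq {Ω : Type*} {k : ℕ} (x y : Fin k → Ω) (hx : Function.Injective x)
    (hy : Function.Injective y) : ∃ σ : Equiv.Perm Ω, ∀ i, σ (x i) = y i :=
  Equiv.Perm.exists_extending_pair x y hx hy

section orbitCollapse

open Equiv

variable {Ω N : Type*} [Monoid N] (g : Perm Ω →* N) (e : N)

open Classical in
/-- The conjugate of `e` by a permutation that maps `p` to `i` and `q` to `j`. -/
noncomputable def orbitCollapse (p q : Ω) (i j : Ω) : N :=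
  if h : ∃ σ : Perm Ω, σ p = i ∧ σ q = j then conjBy g h.choose e else 1

variable {g e} {p q : Ω}

lemma orbitCollapse_apply (h : ∀ σ : Perm Ω, σ p = p → σ q = q → conjBy g σ e = e)
    (σ : Perm Ω) : orbitCollapse g e p q (σ p) (σ q) = conjBy g σ e := by
  have hex : ∃ τ : Perm Ω, τ p = σ p ∧ τ q = σ q := ⟨σ, rfl, rfl⟩
  rw [orbitCollapse, dif_pos hex, conjBy_eq_iff, ← conjBy_mul, h]
  · rw [Perm.mul_apply, Perm.inv_eq_iff_eq, hex.choose_spec.1]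
  · rw [Perm.mul_apply, Perm.inv_eq_iff_eq, hex.choose_spec.2]

lemma orbitCollapse_self (hpq : p ≠ q) (i : Ω) : orbitCollapse g e p q i i = 1 :=
  dif_neg fun ⟨σ, h, h'⟩ => hpq (σ.injective (h.trans h'.symm))

lemma exists_orbitCollapse (h : ∀ σ : Perm Ω, σ p = p → σ q = q → conjBy g σ e = e)
    (hpq : p ≠ q) {i j : Ω} (hij : i ≠ j) :
    ∃ σ : Perm Ω, σ p = i ∧ σ q = j ∧ orbitCollapse g e p q i j = conjBy g σ e := by
  obtain ⟨σ, hσ⟩ := exists_perm_apply_eq ![p, q] ![i, j] (by simpa using hpq) (by simpa using hij)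
  have h0 : σ p = i := hσ 0
  have h1 : σ q = j := hσ 1
  exact ⟨σ, h0, h1, by rw [← h0, ← h1, orbitCollapse_apply h]⟩

lemma conjBy_orbitCollapse (h : ∀ σ : Perm Ω, σ p = p → σ q = q → conjBy g σ e = e)
    (hpq : p ≠ q) (σ : Perm Ω) (i j : Ω) :
    conjBy g σ (orbitCollapse g e p q i j) = orbitCollapse g e p q (σ i) (σ j) := by
  by_cases hij : i = j
  · rw [hij, orbitCollapse_self hpq, orbitCollapse_self hpq, map_one]
  · obtain ⟨τ, rfl, rfl, hτ⟩ := exists_orbitCollapse h hpq hij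
    rw [hτ, ← conjBy_mul, ← orbitCollapse_apply h]
    rfl

/-- If `f` and `s` satisfy `s² = 1`, `f² = f` and `f e f = e s e` for `f = s e s`, then `e` and
`f` commute. -/
lemma commute_of_braid {N : Type*} [Monoid N] {e s : N} (hs : s * s = 1) (he : e * e = e)
    (h : s * e * s * e * s * e * s = e * s * e) :
    e * (s * e * s) = s * e * s * e := by
  have hss : ∀ x, s * (s * x) = x := fun x => by rw [← mul_assoc, hs, one_mul]
  have hee : ∀ x, e * (e * x) = e * x := fun x => by rw [← mul_assoc, he]
  simp only [mul_assoc] at h ⊢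
  -- `e s e` absorbs an outer factor `s e s` on either side.
  have h1 : s * (e * (s * (e * (s * e)))) = e * (s * e) := by
    conv_lhs => rw [← h]
    rw [hss, hee, h]
  have h2 : e * (s * (e * (s * (e * s)))) = e * (s * e) := by
    have : ∀ x, e * (s * (e * x)) = s * (e * (s * (e * (s * (e * (s * x)))))) := fun x => by
      have := congrArg (· * x) h
      simp only [mul_assoc] at this
      exact this.symm
    rw [this, hss, hee, h]
  -- `f e f = e s e`, hence `e s e = e f` and `e s e = f e`.
  have h3 : e * (s * (e * s)) = e * (s * e) := by
    have := congrArg (· * s) h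
    simp only [mul_assoc, hs, mul_one] at this
    rw [← this, h1]
  have h4 : s * (e * (s * e)) = e * (s * e) := by
    have := congrArg (s * ·) h
    simp only [hss] at this
    rw [← this, h2]
  rw [h3, h4]

/-- The conjugates of `e` form a collapse system as soon as `e` is fixed by the permutations
fixing `p` and `q` and satisfies one instance of each of the defining relations. -/
lemma collapseSystem_orbitCollapse [DecidableEq Ω] {r x : Ω} (hpq : p ≠ q) (hpr : p ≠ r) (hqr : q ≠ r)
    (hpx : p ≠ x) (hqx : q ≠ x) (hrx : r ≠ x)
    (h : ∀ σ : Perm Ω, σ p = p → σ q = q → conjBy g σ e = e)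
    (hswap : e * g (swap p q) = e)
    (habs : conjBy g (swap p r) e * e = e)
    (hdisj : e * g (swap p x * swap q r) * e * g (swap p x * swap q r) =
      g (swap p x * swap q r) * e * g (swap p x * swap q r) * e)
    (hbraid : g (swap q r) * e * g (swap q r) * e * g (swap q r) * e * g (swap q r) =
      e * g (swap q r) * e) :
    CollapseSystem g (orbitCollapse g e p q) := by
  have hconj := conjBy_orbitCollapse h hpq
  have hbase : orbitCollapse g e p q p q = e := by
    have := orbitCollapse_apply h 1
    rwa [conjBy_one] at this
  have hE : ∀ (σ : Perm Ω) {i j : Ω}, σ p = i → σ q = j →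
      orbitCollapse g e p q i j = conjBy g σ e := by
    rintro σ _ _ rfl rfl
    exact orbitCollapse_apply h σ
  have hrq : orbitCollapse g e p q r q = conjBy g (swap p r) e :=
    hE _ (swap_apply_left _ _) (swap_apply_of_ne_of_ne hpq.symm hqr)
  have hidem : e * e = e := by
    have h1 : e * conjBy g (swap p r) e = conjBy g (swap p r) e := by
      have := congrArg (conjBy g (swap p r)) habs
      rwa [map_mul, ← conjBy_mul, swap_mul_self, conjBy_one] at this
    calc e * e = e * (conjBy g (swap p r) e * e) := by rw [habs]
      _ = e := by rw [← mul_assoc, h1, habs]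
  have hpr' : orbitCollapse g e p q p r = conjBy g (swap q r) e :=
    hE _ (swap_apply_of_ne_of_ne hpq hpr) (swap_apply_left _ _)
  have hxr : orbitCollapse g e p q x r = conjBy g (swap p x * swap q r) e := by
    refine hE _ ?_ ?_
    · rw [Perm.mul_apply, swap_apply_of_ne_of_ne hpq hpr, swap_apply_left]
    · rw [Perm.mul_apply, swap_apply_left, swap_apply_of_ne_of_ne hpr.symm hrx]
  refine ⟨orbitCollapse_self hpq, fun σ i j => ?_, fun i j hij => ?_, fun a b c hab hcb => ?_,
    fun a b c hab hac hbc => ?_, fun a b c d hab hac had hbc hbd hcd => ?_⟩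
  · rw [mul_conjBy, hconj]
  · obtain ⟨σ, rfl, rfl, hσ⟩ := exists_orbitCollapse h hpq hij
    have := congrArg (conjBy g σ) hswap
    rwa [map_mul, conjBy_perm, ← hσ, ← swap_apply_apply] at this
  · by_cases hac : a = c
    · obtain ⟨σ, _, _, hσ⟩ := exists_orbitCollapse h hpq hab
      rw [← hac, hσ, ← map_mul, hidem]
    · obtain ⟨σ, hσ⟩ := exists_perm_apply_eq ![p, q, r] ![c, b, a]
        (by simp [Function.Injective, Fin.forall_fin_succ, *, Ne.symm, eq_comm])
        (by simp [Function.Injective, Fin.forall_fin_succ, *, Ne.symm, eq_comm]; grind)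
      have h0 : σ p = c := hσ 0
      have h1 : σ q = b := hσ 1
      have h2 : σ r = a := hσ 2
      rw [← h0, ← h1, ← h2, ← hconj, ← hconj, hrq, hbase, ← map_mul, habs]
  · obtain ⟨σ, hσ⟩ := exists_perm_apply_eq ![p, q, r] ![a, b, c]
        (by simp [Function.Injective, Fin.forall_fin_succ, *, Ne.symm, eq_comm])
        (by simp [Function.Injective, Fin.forall_fin_succ, *, Ne.symm, eq_comm])
    have h0 : σ p = a := hσ 0
    have h1 : σ q = b := hσ 1
    have h2 : σ r = c := hσ 2
    rw [← h0, ← h1, ← h2, ← hconj, ← hconj, hpr', hbase, ← map_mul, ← map_mul, conjBy_swap,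
      commute_of_braid (CollapseSystem.g_swap_mul_self g q r) hidem hbraid]
  · obtain ⟨σ, hσ⟩ := exists_perm_apply_eq ![p, q, x, r] ![a, b, c, d]
        (by simp [Function.Injective, Fin.forall_fin_succ, *, Ne.symm, eq_comm])
        (by simp [Function.Injective, Fin.forall_fin_succ, *, Ne.symm, eq_comm])
    have h0 : σ p = a := hσ 0
    have h1 : σ q = b := hσ 1
    have h2 : σ x = c := hσ 2
    have h3 : σ r = d := hσ 3
    have hinv : (swap p x * swap q r)⁻¹ = swap p x * swap q r := by
      rw [mul_inv_rev, swap_inv, swap_inv]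
      refine (Perm.Disjoint.commute fun y => ?_).eq
      rw [or_iff_not_imp_left]
      intro hy
      rcases (swap_apply_ne_self_iff.1 hy).2 with rfl | rfl
      · exact swap_apply_of_ne_of_ne hpq.symm hqx
      · exact swap_apply_of_ne_of_ne hpr.symm hrx
    rw [← h0, ← h1, ← h2, ← h3, ← hconj, ← hconj, hxr, hbase, ← map_mul, ← map_mul,
      conjBy_apply g (swap p x * swap q r), hinv, ← hdisj]
    simp only [mul_assoc]

end orbitCollapse

/-! ### Consequences of the action of transpositions on one collapse -/

section transpositions

open Equiv

variable {Ω N : Type*} [DecidableEq Ω] [Monoid N] {g : Perm Ω →* N} {e : N}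

lemma conjBy_swap_involutive (g : Perm Ω →* N) (a b : Ω) (x : N) :
    conjBy g (swap a b) (conjBy g (swap a b) x) = x := by
  rw [← conjBy_mul, swap_mul_self, conjBy_one]

lemma conjBy_g_swap (g : Perm Ω →* N) (σ : Perm Ω) (a b : Ω) :
    conjBy g σ (g (swap a b)) = g (swap (σ a) (σ b)) := by
  rw [conjBy_perm, ← swap_apply_apply]

/-- Conjugation by a permutation `σ`, moved past a transposition. -/
lemma conjBy_conjBy_swap (g : Perm Ω →* N) (σ : Perm Ω) (a b : Ω) (x : N) :
    conjBy g σ (conjBy g (swap a b) x) = conjBy g (swap (σ a) (σ b)) (conjBy g σ x) := by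
  rw [swap_apply_apply, ← conjBy_mul, ← conjBy_mul, inv_mul_cancel_right]

/-- If all transpositions with a given centre `r` exchange `e` with the same element `d`, then so
do all transpositions of points other than `p` and `q`. -/
lemma conjBy_swap_eq_of_star {p q r : Ω} {d : N}
    (h : ∀ a, a ≠ p → a ≠ q → a ≠ r → conjBy g (swap r a) e = d) {a b : Ω} (hap : a ≠ p)
    (haq : a ≠ q) (hbp : b ≠ p) (hbq : b ≠ q) (hab : a ≠ b) : conjBy g (swap a b) e = d := by
  by_cases har : a = r
  · rw [har]; exact h b hbp hbq (har ▸ hab.symm)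
  by_cases hbr : b = r
  · rw [hbr, swap_comm]; exact h a hap haq har
  have h2 := conjBy_conjBy_swap g (swap r b) r a e
  rw [swap_apply_left, swap_apply_of_ne_of_ne har hab, h a hap haq har, h b hbp hbq hbr] at h2
  have h3 : conjBy g (swap r b) d = e := by
    rw [← h b hbp hbq hbr, conjBy_swap_involutive]
  rw [swap_comm, ← h3, h2, conjBy_swap_involutive]

/-- If all transpositions of points other than `p` and `q` exchange `e` and `d`, then so does a
cycle, according to the parity of its length. -/
lemma conjBy_formPerm {p q : Ω} {d : N}
    (h : ∀ a b, a ≠ p → a ≠ q → b ≠ p → b ≠ q → a ≠ b → conjBy g (swap a b) e = d)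
    (a : Ω) (l : List Ω) (hl : (a :: l).Nodup) (hp : p ∉ a :: l) (hq : q ∉ a :: l) :
    conjBy g (a :: l).formPerm e = if Even l.length then e else d := by
  induction l generalizing a with
  | nil => rw [List.formPerm_singleton, conjBy_one]; rfl
  | cons b l ih =>
    rw [List.formPerm_cons_cons, conjBy_mul,
      ih b (List.nodup_cons.1 hl).2 (fun h => hp (List.mem_cons_of_mem _ h))
        (fun h => hq (List.mem_cons_of_mem _ h)), List.length_cons]
    simp only [List.mem_cons, List.nodup_cons, not_or] at hp hq hl
    have hab := h a b (Ne.symm hp.1) (Ne.symm hq.1) (Ne.symm hp.2.1) (Ne.symm hq.2.1) hl.1.1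
    by_cases hev : Even l.length
    · rw [if_pos hev, hab, if_neg (by rwa [Nat.even_add_one, not_not])]
    · rw [if_neg hev, if_pos (Nat.even_add_one.2 hev), ← hab, conjBy_swap_involutive]

lemma conjBy_eq_self_of_swap [Finite Ω] {p q : Ω}
    (h : ∀ a b, a ≠ p → a ≠ q → b ≠ p → b ≠ q → a ≠ b → conjBy g (swap a b) e = e)
    (σ : Perm Ω) (hp : σ p = p) (hq : σ q = q) : conjBy g σ e = e := by
  have key : ∀ τ : Perm {x // x ≠ p ∧ x ≠ q}, conjBy g (Perm.ofSubtype τ) e = e := by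
    intro τ
    induction τ using Perm.swap_induction_on with
    | one => rw [map_one, conjBy_one]
    | swap_mul τ x y hxy ih =>
      rw [map_mul, Perm.ofSubtype_swap_eq, conjBy_mul, ih,
        h _ _ x.2.1 x.2.2 y.2.1 y.2.2 (Subtype.coe_injective.ne hxy)]
  have hinv : ∀ x, (σ x ≠ p ∧ σ x ≠ q) ↔ (x ≠ p ∧ x ≠ q) := fun x => by
    rw [← hp, ← hq, σ.injective.ne_iff, σ.injective.ne_iff, hp, hq]
  have := key (σ.subtypePerm hinv)
  rwa [Perm.ofSubtype_subtypePerm] at this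
  intro x hx
  exact ⟨by rintro rfl; exact hx hp, by rintro rfl; exact hx hq⟩

/-- If every transposition of points other than `p` and `q` maps `e` to `e (p q)`, and
`f e = e (p q)` for the conjugate `f` of `e` by `(p r)`, then `e (p q) = e`. -/
lemma mul_swap_eq_self {p q r x y z : Ω} (hd : [p, q, r, x, y, z].Nodup)
    (h : ∀ a b, a ≠ p → a ≠ q → b ≠ p → b ≠ q → a ≠ b →
      conjBy g (swap a b) e = e * g (swap p q))
    (hf : conjBy g (swap p r) e * e = e * g (swap p q)) : e * g (swap p q) = e := by
  simp only [List.nodup_cons, List.mem_cons, not_or, List.not_mem_nil, not_false_eq_true,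
    List.nodup_nil, and_true] at hd
  obtain ⟨⟨hpq, hpr, hpx, hpy, hpz⟩, ⟨hqr, hqx, hqy, hqz⟩, ⟨hrx, hry, hrz⟩, ⟨hxy, hxz⟩, hyz⟩ := hd
  have htt : ∀ m, m * g (swap p q) * g (swap p q) = m := fun m => by
    rw [mul_assoc, CollapseSystem.g_swap_mul_self, mul_one]
  have hxy' := h x y (Ne.symm hpx) (Ne.symm hqx) (Ne.symm hpy) (Ne.symm hqy) hxy
  have hyz' := h y z (Ne.symm hpy) (Ne.symm hqy) (Ne.symm hpz) (Ne.symm hqz) hyz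
  have hrx' := h r x (Ne.symm hpr) (Ne.symm hqr) (Ne.symm hpx) (Ne.symm hqx) hrx
  have hrt : conjBy g (swap p r) (g (swap p q)) = g (swap r q) := by
    rw [conjBy_g_swap, swap_apply_left, swap_apply_of_ne_of_ne (Ne.symm hpq) hqr]
  have ht : ∀ {a b : Ω}, p ≠ a → p ≠ b → q ≠ a → q ≠ b →
      conjBy g (swap a b) (g (swap p q)) = g (swap p q) := fun h1 h2 h3 h4 => by
    rw [conjBy_g_swap, swap_apply_of_ne_of_ne h1 h2, swap_apply_of_ne_of_ne h3 h4]
  -- The conjugate of `hf` by `(x y)`.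
  have h1 : conjBy g (swap p r) e * g (swap r q) * e = e * g (swap p q) := by
    have := congrArg (conjBy g (swap x y)) hf
    rw [map_mul, map_mul, conjBy_conjBy_swap, swap_apply_of_ne_of_ne hpx hpy,
      swap_apply_of_ne_of_ne hrx hry, hxy', map_mul, hrt, ht hpx hpy hqx hqy, htt,
      ← mul_assoc] at this
    conv_rhs => rw [← this]
    rw [htt]
  -- The conjugate of `hf` by `(p r)(r x)`.
  have h2 : conjBy g (swap p x) e * conjBy g (swap p r) e =
      conjBy g (swap p r) e * g (swap r q) := by
    have := congrArg (fun m => conjBy g (swap p r) (conjBy g (swap r x) m)) hf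
    simp only [map_mul] at this
    rw [hrx', conjBy_conjBy_swap g (swap p r) r x, swap_apply_right,
      swap_apply_of_ne_of_ne (Ne.symm hpx) (Ne.symm hrx), conjBy_swap_involutive,
      ht hpr hpx hqr hqx, ← map_mul _ (e * _), htt, map_mul, hrt, ← mul_assoc] at this
    conv_rhs => rw [← this]
    rw [mul_assoc, CollapseSystem.g_swap_mul_self, mul_one]
  -- The conjugate of `hf` by `(r x)(y z)`.
  have h3 : conjBy g (swap p x) e * e = e * g (swap p q) := by
    have := congrArg (fun m => conjBy g (swap r x) (conjBy g (swap y z) m)) hf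
    simp only [map_mul] at this
    rw [conjBy_conjBy_swap g (swap y z), swap_apply_of_ne_of_ne hpy hpz,
      swap_apply_of_ne_of_ne hry hrz, hyz', conjBy_conjBy_swap g (swap r x), swap_apply_left,
      swap_apply_of_ne_of_ne hpr hpx, map_mul, hrx', ht hpy hpz hqy hqz, ht hpr hpx hqr hqx,
      htt] at this
    exact this
  have h4 : conjBy g (swap p x) e * (conjBy g (swap p r) e * e) = e * g (swap p q) := by
    rw [← mul_assoc, h2, h1]
  rw [hf, ← mul_assoc, h3, htt] at h4
  exact h4.symm

end transpositions

/-! ### The relations for `α` and `β` -/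

section alphaBeta

open Equiv

variable {n : ℕ}

/-- The cycle through the points from the index `k` on. -/
def tailCycle (n k : ℕ) : Perm (Fin n) := ((List.finRange n).drop k).formPerm

lemma drop_finRange {k : ℕ} (hk : k < n) :
    (List.finRange n).drop k = ⟨k, hk⟩ :: (List.finRange n).drop (k + 1) := by
  rw [List.drop_eq_getElem_cons (by simpa using hk)]
  simp

lemma mem_drop_finRange {k : ℕ} {x : Fin n} : x ∈ (List.finRange n).drop k ↔ k ≤ x.val := by
  rw [List.mem_iff_getElem]
  simp only [List.length_drop, List.length_finRange, List.getElem_drop, List.getElem_finRange]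
  constructor
  · rintro ⟨i, hi, rfl⟩
    simp
  · intro h
    exact ⟨x.val - k, by omega, by ext; simp; omega⟩

lemma nodup_drop_finRange (n k : ℕ) : ((List.finRange n).drop k).Nodup :=
  (List.nodup_finRange n).sublist (List.drop_sublist _ _)

lemma tailCycle_eq_swap_mul {k : ℕ} (hk : k + 1 < n) :
    tailCycle n k = swap ⟨k, by omega⟩ ⟨k + 1, hk⟩ * tailCycle n (k + 1) := by
  unfold tailCycle
  rw [drop_finRange (k := k) (by omega), drop_finRange hk, List.formPerm_cons_cons]

lemma tailCycle_apply_of_lt {k : ℕ} {x : Fin n} (hx : x.val < k) : tailCycle n k x = x :=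
  List.formPerm_apply_of_notMem (by rw [mem_drop_finRange]; omega)

lemma tailCycle_apply_succ {k i : ℕ} (hk : k ≤ i) (hi : i + 1 < n) :
    tailCycle n k ⟨i, by omega⟩ = ⟨i + 1, hi⟩ := by
  have := List.formPerm_apply_lt_getElem _ (nodup_drop_finRange n k) (i - k) (by simp; omega)
  simp only [List.getElem_drop, List.getElem_finRange] at this
  refine (congrArg _ ?_).trans (this.trans ?_) <;> ext <;> simp <;> omega

/-- The cycle through `c` and the points from the index `k` on. -/
def consTailCycle (n k : ℕ) (c : Fin n) : Perm (Fin n) := (c :: (List.finRange n).drop k).formPerm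

lemma nodup_cons_drop_finRange {k : ℕ} {c : Fin n} (hc : c.val < k) :
    (c :: (List.finRange n).drop k).Nodup :=
  List.nodup_cons.2 ⟨by rw [mem_drop_finRange]; omega, nodup_drop_finRange n k⟩

lemma consTailCycle_eq_swap_mul {k : ℕ} {c : Fin n} (hk : k < n) :
    consTailCycle n k c = swap c ⟨k, hk⟩ * tailCycle n k := by
  unfold consTailCycle tailCycle
  rw [drop_finRange hk, List.formPerm_cons_cons]

lemma consTailCycle_apply_of_lt {k : ℕ} {c x : Fin n} (hx : x.val < k) (hxc : x ≠ c) :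
    consTailCycle n k c x = x :=
  List.formPerm_apply_of_notMem (by rw [List.mem_cons, mem_drop_finRange]; omega)

lemma consTailCycle_apply_succ {k i : ℕ} {c : Fin n} (hc : c.val < k) (hk : k ≤ i)
    (hi : i + 1 < n) : consTailCycle n k c ⟨i, by omega⟩ = ⟨i + 1, hi⟩ := by
  have := tailCycle_apply_succ hk hi
  rw [consTailCycle_eq_swap_mul (by omega), Perm.mul_apply, this]
  refine swap_apply_of_ne_of_ne ?_ ?_ <;> · intro h; simp [Fin.ext_iff] at h; omega

lemma consTailCycle_apply_last {k i : ℕ} {c : Fin n} (hk : k < n) (hi : i + 1 = n) :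
    consTailCycle n k c ⟨i, by omega⟩ = c := by
  have := List.formPerm_apply_getElem_length c ((List.finRange n).drop k)
  have hlen : ((List.finRange n).drop k).length = n - k - 1 + 1 := by simp; omega
  simp only [hlen, List.getElem_cons_succ, List.getElem_drop, List.getElem_finRange] at this
  refine Eq.trans (congrArg _ ?_) this
  ext
  simp
  omega

variable {N : Type*} [Monoid N] {g : Perm (Fin n) →* N} {e : N}

/-- If `β = α γ` and the conjugate of `e` by `β` is the conjugate by `α` times `(p q)`, where `α`
fixes `p` and `q`, then `γ` maps `e` to `e (p q)`. -/
lemma conjBy_quotient {α γ : Perm (Fin n)} {p q : Fin n} {m : N} (hp : α p = p) (hq : α q = q)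
    (hα : conjBy g α e = m) (hβ : conjBy g (α * γ) e = m * g (swap p q)) :
    conjBy g γ e = e * g (swap p q) := by
  have h : conjBy g (α * γ) e = conjBy g α (e * g (swap p q)) := by
    rw [map_mul, conjBy_g_swap, hp, hq, hα, hβ]
  rwa [conjBy_mul, conjBy_eq_iff, ← conjBy_mul, inv_mul_cancel, conjBy_one] at h

lemma mul_g_swap_cancel (g : Perm (Fin n) →* N) (p q : Fin n) (m : N) :
    m * g (swap p q) * g (swap p q) = m := by
  rw [mul_assoc, CollapseSystem.g_swap_mul_self, mul_one]

lemma mul_g_swap_injective (g : Perm (Fin n) →* N) (p q : Fin n) :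
    Function.Injective (fun m : N => m * g (swap p q)) :=
  Function.LeftInverse.injective (g := fun m : N => m * g (swap p q))
    (mul_g_swap_cancel g p q)

lemma conjBy_mul_swap {σ : Perm (Fin n)} {p q : Fin n} (hp : σ p = p) (hq : σ q = q) (m : N) :
    conjBy g σ (m * g (swap p q)) = conjBy g σ m * g (swap p q) := by
  rw [map_mul, conjBy_g_swap, hp, hq]

lemma three_cycle_identity {Ω : Type*} [DecidableEq Ω] {r a b c d : Ω}
    (h : [r, a, b, c, d].Nodup) :
    swap r a * swap r d = (swap r a * swap r b) * (swap r c * swap r d) *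
      (swap r a * swap r b) * (swap r d * swap r c) * (swap r b * swap r a) := by
  simp only [List.nodup_cons, List.mem_cons, not_or, List.not_mem_nil, not_false_eq_true,
    List.nodup_nil, and_true] at h
  ext1 x
  simp only [Perm.mul_apply, swap_apply_def]
  grind

lemma five_cycle_identity {Ω : Type*} [DecidableEq Ω] {a b c d f : Ω}
    (h : [a, b, c, d, f].Nodup) :
    swap a b * swap b c * swap c d * swap d f =
      swap a f * swap f d * swap d b * swap b c * swap a d * swap c f := by
  simp only [List.nodup_cons, List.mem_cons, not_or, List.not_mem_nil, not_false_eq_true,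
    List.nodup_nil, and_true] at h
  ext1 x
  simp only [Perm.mul_apply, swap_apply_def]
  grind

/-- For odd `n`, the quotient `γ = α⁻¹β` is the cycle through all points except `p`, `q`, `r`. It
maps `e` to `e (p q)`, so its square fixes both `e` and `f e`, the conjugate of `e` by the
transposition `α`; hence the conjugates of `e` by the transpositions `(r a)` and `(r γ²(a))`
agree. Products of the resulting 3-cycles link the two orbits of `γ²`. -/
lemma star_of_relations_odd (hn : 7 ≤ n) (hodd : Odd n) {p q r : Fin n} (hp : p.val = 0)
    (hq : q.val = 1) (hr : r.val = 2)
    (hα : conjBy g (swap r ⟨3, by omega⟩) e = conjBy g (swap p r) e * e)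
    (hβ : conjBy g (tailCycle n 2) e = conjBy g (swap p r) e * e * g (swap p q)) :
    (∀ a, a ≠ p → a ≠ q → a ≠ r → conjBy g (swap r a) e = e * g (swap p q)) ∧
      conjBy g (swap p r) e * e = e * g (swap p q) := by
  have hr2 : r = ⟨2, by omega⟩ := Fin.ext hr
  have hγe : conjBy g (tailCycle n 3) e = e * g (swap p q) := by
    refine conjBy_quotient (α := swap r ⟨3, by omega⟩) ?_ ?_ hα ?_
    · apply swap_apply_of_ne_of_ne <;> rw [Fin.ne_iff_vne] <;> simp [hp, hr]
    · apply swap_apply_of_ne_of_ne <;> rw [Fin.ne_iff_vne] <;> simp [hq, hr]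
    · rw [hr2, ← tailCycle_eq_swap_mul, hβ, hr2]
  have hγp : tailCycle n 3 p = p := tailCycle_apply_of_lt (by omega)
  have hγq : tailCycle n 3 q = q := tailCycle_apply_of_lt (by omega)
  have hγr : tailCycle n 3 r = r := tailCycle_apply_of_lt (by omega)
  have hγγ : ∀ x, conjBy g (tailCycle n 3) (conjBy g (tailCycle n 3) (conjBy g (swap p r) x)) =
      conjBy g (swap p r) (conjBy g (tailCycle n 3) (conjBy g (tailCycle n 3) x)) := fun x => by
    rw [conjBy_conjBy_swap, conjBy_conjBy_swap, hγp, hγr, hγp, hγr]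
  have hγγe : conjBy g (tailCycle n 3) (conjBy g (tailCycle n 3) e) = e := by
    rw [hγe, conjBy_mul_swap hγp hγq, hγe, mul_g_swap_cancel]
  have hγD : ∀ a, a ≠ p → a ≠ q → conjBy g (tailCycle n 3) (conjBy g (swap r a) e) =
      conjBy g (swap r (tailCycle n 3 a)) e * g (swap p q) := fun a hap haq => by
    have h1 : tailCycle n 3 a ≠ p := fun h => hap ((tailCycle n 3).injective (h.trans hγp.symm))
    have h2 : tailCycle n 3 a ≠ q := fun h => haq ((tailCycle n 3).injective (h.trans hγq.symm))
    rw [conjBy_conjBy_swap, hγr, hγe, conjBy_mul_swap] <;>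
      refine swap_apply_of_ne_of_ne ?_ (Ne.symm ‹_›) <;> rw [Fin.ne_iff_vne] <;> omega
  have hstep : ∀ i j : ℕ, 3 ≤ i → 3 ≤ j → ∀ (hi : i + 1 < n) (hj : j + 1 < n),
      conjBy g (swap r ⟨i, by omega⟩) e = conjBy g (swap r ⟨j, by omega⟩) e →
      conjBy g (swap r ⟨i + 1, hi⟩) e = conjBy g (swap r ⟨j + 1, hj⟩) e := by
    intro i j hi3 hj3 hi hj h
    have := congrArg (conjBy g (tailCycle n 3)) h
    rw [hγD _ (by rw [Fin.ne_iff_vne]; simp; omega) (by rw [Fin.ne_iff_vne]; simp; omega),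
      hγD _ (by rw [Fin.ne_iff_vne]; simp; omega) (by rw [Fin.ne_iff_vne]; simp; omega),
      tailCycle_apply_succ hi3 hi, tailCycle_apply_succ hj3 hj] at this
    exact mul_g_swap_injective g p q this
  have h35 : conjBy g (swap r ⟨3, by omega⟩) e = conjBy g (swap r ⟨5, by omega⟩) e := by
    have h1 : conjBy g (tailCycle n 3) (conjBy g (tailCycle n 3)
        (conjBy g (swap r ⟨3, by omega⟩) e)) = conjBy g (swap r ⟨3, by omega⟩) e := by
      rw [hα, map_mul, map_mul, hγγ, hγγe]
    rw [← h1, hγD _ (by rw [Fin.ne_iff_vne]; simp; omega) (by rw [Fin.ne_iff_vne]; simp; omega),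
      conjBy_mul_swap hγp hγq, tailCycle_apply_succ le_rfl (by omega),
      hγD _ (by rw [Fin.ne_iff_vne]; simp; omega) (by rw [Fin.ne_iff_vne]; simp; omega),
      mul_g_swap_cancel, tailCycle_apply_succ (by omega) (by omega)]
  have htwo : ∀ i : ℕ, 3 ≤ i → ∀ hi : i + 2 < n,
      conjBy g (swap r ⟨i, by omega⟩) e = conjBy g (swap r ⟨i + 2, hi⟩) e := by
    intro i hi
    induction i, hi using Nat.le_induction with
    | base => exact fun _ => h35
    | succ i hi ih =>
      exact fun hin => hstep i (i + 2) hi (by omega) (by omega) (by omega) (ih (by omega))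
  have h36 : conjBy g (swap r ⟨3, by omega⟩) e = conjBy g (swap r ⟨6, by omega⟩) e := by
    have hcancel : ∀ a b, conjBy g (swap r a) e = conjBy g (swap r b) e →
        conjBy g (swap r a * swap r b) e = e := fun a b h => by
      rw [conjBy_mul, ← h, conjBy_swap_involutive]
    have h46 := htwo 4 (by omega) (by omega)
    have := three_cycle_identity (r := r) (a := ⟨3, by omega⟩) (b := ⟨5, by omega⟩)
      (c := ⟨4, by omega⟩) (d := ⟨6, by omega⟩) (by simp [hr2])
    have h1 : conjBy g (swap r ⟨3, by omega⟩ * swap r ⟨6, by omega⟩) e = e := by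
      rw [this, conjBy_mul, conjBy_mul, conjBy_mul, conjBy_mul, hcancel _ _ h35.symm,
        hcancel _ _ h46.symm, hcancel _ _ h35, hcancel _ _ h46, hcancel _ _ h35]
    rw [conjBy_mul] at h1
    conv_lhs => rw [← h1]
    rw [conjBy_swap_involutive]
  have hall : ∀ (i : ℕ) (hi : i < n), 3 ≤ i →
      conjBy g (swap r ⟨i, hi⟩) e = conjBy g (swap r ⟨3, by omega⟩) e := by
    intro i
    induction i using Nat.strong_induction_on with
    | _ i ih =>
      intro hi h3
      by_cases hi3 : i = 3
      · subst hi3; rfl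
      by_cases hi4 : i = 4
      · subst hi4
        rw [h36]
        exact htwo 4 (by omega) (by omega)
      · obtain ⟨k, rfl⟩ : ∃ k, i = k + 2 := ⟨i - 2, by omega⟩
        rw [← htwo k (by omega) hi]
        exact ih k (by omega) (by omega) (by omega)
  have hstar : ∀ a, a ≠ p → a ≠ q → a ≠ r →
      conjBy g (swap r a) e = conjBy g (swap r ⟨3, by omega⟩) e := by
    intro a h1 h2 h3
    rw [Fin.ne_iff_vne] at h1 h2 h3
    exact hall a.val a.isLt (by omega)
  -- As `γ` is a cycle of even length, it exchanges `e` with its conjugate by a transposition.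
  have hd : e * g (swap p q) = conjBy g (swap r ⟨3, by omega⟩) e := by
    have := conjBy_formPerm (p := p) (q := q)
      (fun a b ha ha' hb hb' hab => conjBy_swap_eq_of_star hstar ha ha' hb hb' hab)
      ⟨3, by omega⟩ ((List.finRange n).drop 4)
      (by rw [← drop_finRange]; exact nodup_drop_finRange n 3)
      (by rw [← drop_finRange, mem_drop_finRange]; omega)
      (by rw [← drop_finRange, mem_drop_finRange]; omega)
    rw [← drop_finRange, if_neg] at this
    · rw [← this, ← hγe]; rfl
    · rw [List.length_drop, List.length_finRange, Nat.not_even_iff_odd]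
      exact Nat.Odd.sub_even (by omega) hodd (by decide)
  exact ⟨fun a h1 h2 h3 => (hstar a h1 h2 h3).trans hd.symm, hα.symm.trans hd.symm⟩

/-- For even `n`, the quotient `α⁻¹β` is, up to inversion, the product of the transposition
`(r s)`, where `s` has index 5, and a disjoint cycle `F` of odd length. As it maps `e` to
`e (p q)`, so does `(r s)`, while `F` fixes `e`. As `F` also fixes `f`, hence the conjugate of `e`
by `α`, the permutation `α⁻¹ F α` fixes `e`, and conjugating `(r s)` by it and by `F` gives
all transpositions `(r a)`. -/
lemma star_of_relations_even (hn : 8 ≤ n) (heven : Even n) {p q r : Fin n} (hp : p.val = 0)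
    (hq : q.val = 1) (hr : r.val = 2)
    (hα : conjBy g (tailCycle n 2) e = conjBy g (swap p r) e * e)
    (hβ : conjBy g [r, ⟨6, by omega⟩, ⟨5, by omega⟩, ⟨3, by omega⟩, ⟨4, by omega⟩].formPerm e =
      conjBy g (swap p r) e * e * g (swap p q)) :
    (∀ a, a ≠ p → a ≠ q → a ≠ r → conjBy g (swap r a) e = e * g (swap p q)) ∧
      conjBy g (swap p r) e * e = e * g (swap p q) := by
  have hr2 : r = ⟨2, by omega⟩ := Fin.ext hr
  set β := [r, ⟨6, by omega⟩, ⟨5, by omega⟩, ⟨3, by omega⟩, ⟨4, by omega⟩].formPerm with hβdef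
  set F := consTailCycle n 6 ⟨4, by omega⟩ with hF
  have hfac : tailCycle n 2 = β * (swap r ⟨5, by omega⟩ * F) := by
    have h5 := five_cycle_identity (a := r) (b := ⟨3, by omega⟩) (c := ⟨4, by omega⟩)
      (d := ⟨5, by omega⟩) (f := ⟨6, by omega⟩) (by simp [hr2])
    rw [tailCycle_eq_swap_mul (by omega), tailCycle_eq_swap_mul (by omega),
      tailCycle_eq_swap_mul (by omega), tailCycle_eq_swap_mul (by omega), hF,
      consTailCycle_eq_swap_mul (by omega), hβdef]
    simp only [List.formPerm_cons_cons, List.formPerm_singleton, mul_one, ← mul_assoc]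
    rw [hr2] at h5 ⊢
    exact congrArg (· * tailCycle n 6) h5
  have hFx : ∀ {x : Fin n}, x.val < 6 → x.val ≠ 4 → F x = x := fun h h' =>
    consTailCycle_apply_of_lt h (by rw [Fin.ne_iff_vne]; exact h')
  have hFp : F p = p := hFx (by omega) (by omega)
  have hFq : F q = q := hFx (by omega) (by omega)
  have hFr : F r = r := hFx (by omega) (by omega)
  have hαp : tailCycle n 2 p = p := tailCycle_apply_of_lt (by omega)
  have hαq : tailCycle n 2 q = q := tailCycle_apply_of_lt (by omega)
  have hβp : p ∉ [r, ⟨6, by omega⟩, ⟨5, by omega⟩, ⟨3, by omega⟩, ⟨4, by omega⟩] := by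
    simp [Fin.ext_iff, hp, hr]
  have hβq : q ∉ [r, ⟨6, by omega⟩, ⟨5, by omega⟩, ⟨3, by omega⟩, ⟨4, by omega⟩] := by
    simp [Fin.ext_iff, hq, hr]
  have hε : conjBy g (swap r ⟨5, by omega⟩ * F) e = e * g (swap p q) :=
    conjBy_quotient (List.formPerm_apply_of_notMem hβp) (List.formPerm_apply_of_notMem hβq) hβ
      (by rw [← hfac, hα, mul_g_swap_cancel])
  have hs : ∀ {x : Fin n}, x.val ≠ 2 → x.val ≠ 5 → swap r ⟨5, by omega⟩ x = x := fun h h' =>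
    swap_apply_of_ne_of_ne (by rw [Fin.ne_iff_vne, hr]; exact h) (by rw [Fin.ne_iff_vne]; exact h')
  have hcomm : Commute (swap r ⟨5, by omega⟩) F := by
    have := swap_apply_apply F r ⟨5, by omega⟩
    rw [hFr, hFx (x := ⟨5, by omega⟩) (by simp) (by simp), eq_mul_inv_iff_mul_eq] at this
    exact this
  have hFpow : F ^ (n - 5) = 1 := by
    have := List.formPerm_pow_length_eq_one_of_nodup _
      (nodup_cons_drop_finRange (n := n) (k := 6) (c := ⟨4, by omega⟩) (by simp))
    rwa [List.length_cons, List.length_drop, List.length_finRange,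
      show n - 6 + 1 = n - 5 by omega] at this
  have hs5 : conjBy g (swap r ⟨5, by omega⟩) e = e * g (swap p q) := by
    obtain ⟨k, hk⟩ : Odd (n - 5) := Nat.Even.sub_odd (by omega) heven (by decide)
    have hsq : conjBy g ((swap r ⟨5, by omega⟩ * F) ^ 2) e = e := by
      rw [sq, conjBy_mul, hε, conjBy_mul_swap, hε, mul_g_swap_cancel]
      · rw [Perm.mul_apply, hFp, hs (by omega) (by omega)]
      · rw [Perm.mul_apply, hFq, hs (by omega) (by omega)]
    have hev : ∀ k : ℕ, conjBy g (((swap r ⟨5, by omega⟩ * F) ^ 2) ^ k) e = e := by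
      intro k
      induction k with
      | zero => rw [pow_zero, conjBy_one]
      | succ k ih => rw [pow_succ, conjBy_mul, hsq, ih]
    have hpow : (swap r ⟨5, by omega⟩ * F) ^ (n - 5) = swap r ⟨5, by omega⟩ := by
      rw [hcomm.mul_pow, hFpow, mul_one, hk, pow_succ, pow_mul, sq, swap_mul_self, one_pow,
        one_mul]
    rw [← hpow, hk, pow_succ', pow_mul, conjBy_mul, hev, hε]
  have hFe : conjBy g F e = e := by
    rw [conjBy_mul] at hε
    have := congrArg (conjBy g (swap r ⟨5, by omega⟩)) hε
    rwa [conjBy_swap_involutive, conjBy_mul_swap (hs (by omega) (by omega))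
      (hs (by omega) (by omega)), hs5, mul_g_swap_cancel] at this
  have hGe : conjBy g ((tailCycle n 2)⁻¹ * F * tailCycle n 2) e = e := by
    rw [conjBy_mul, conjBy_mul, hα, map_mul, conjBy_conjBy_swap, hFp, hFr, hFe, ← hα,
      ← conjBy_mul, inv_mul_cancel, conjBy_one]
  have hG : ∀ {x y : Fin n}, F (tailCycle n 2 x) = tailCycle n 2 y →
      ((tailCycle n 2)⁻¹ * F * tailCycle n 2) x = y := fun h => by
    rw [Perm.mul_apply, Perm.mul_apply, Perm.inv_eq_iff_eq, h]
  have hα3 : tailCycle n 2 r = ⟨3, by omega⟩ := by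
    rw [hr2]; exact tailCycle_apply_succ le_rfl (by omega)
  have hstep : ∀ σ : Perm (Fin n), σ p = p → σ q = q → σ r = r → conjBy g σ e = e →
      ∀ a b, σ a = b → conjBy g (swap r a) e = e * g (swap p q) →
        conjBy g (swap r b) e = e * g (swap p q) := by
    rintro σ h1 h2 h3 h4 a _ rfl h5
    have := conjBy_conjBy_swap g σ r a e
    rw [h5, conjBy_mul_swap h1 h2, h3, h4] at this
    exact this.symm
  have hstepF := hstep F hFp hFq hFr hFe
  have hstepG := hstep _ (hG (by rw [hαp, hFp])) (hG (by rw [hαq, hFq]))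
    (hG (by rw [hα3, hFx (by simp) (by simp)])) hGe
  have hmid : ∀ i : ℕ, 5 ≤ i → ∀ hi : i + 1 < n,
      conjBy g (swap r ⟨i, by omega⟩) e = e * g (swap p q) := by
    intro i hi
    induction i, hi using Nat.le_induction with
    | base => exact fun _ => hs5
    | succ i hi ih =>
      intro hin
      refine hstepG _ _ (hG ?_) (ih (by omega))
      rw [tailCycle_apply_succ (by omega) (by omega), tailCycle_apply_succ (by omega) hin]
      exact consTailCycle_apply_succ (by simp) (by omega) hin
  have hlast : conjBy g (swap r ⟨n - 1, by omega⟩) e = e * g (swap p q) := by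
    refine hstepF _ _ ?_ (hmid (n - 2) (by omega) (by omega))
    rw [hF, consTailCycle_apply_succ (by simp) (by omega) (by omega)]
    ext; simp; omega
  have h4 : conjBy g (swap r ⟨4, by omega⟩) e = e * g (swap p q) :=
    hstepF _ _ (consTailCycle_apply_last (by omega) (by omega)) hlast
  have h3 : conjBy g (swap r ⟨3, by omega⟩) e = e * g (swap p q) := by
    refine hstepG _ _ (hG ?_) (hmid (n - 2) (by omega) (by omega))
    rw [tailCycle_apply_succ (by omega) (by omega), tailCycle_apply_succ (by omega) (by omega)]
    exact consTailCycle_apply_last (by omega) (by omega)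
  have hstar : ∀ a, a ≠ p → a ≠ q → a ≠ r → conjBy g (swap r a) e = e * g (swap p q) := by
    rintro ⟨a, ha⟩ h0 h1 h2
    rw [Fin.ne_iff_vne] at h0 h1 h2
    by_cases ha3 : a = 3
    · subst ha3; exact h3
    by_cases ha4 : a = 4
    · subst ha4; exact h4
    by_cases han : a = n - 1
    · subst han; exact hlast
    exact hmid a (by simp at h0 h1 h2; omega) (by omega)
  refine ⟨hstar, ?_⟩
  -- The 5-cycle `β` is a product of four transpositions that exchange `e` and `e (p q)`.
  have := conjBy_formPerm
    (fun a b ha ha' hb hb' hab => conjBy_swap_eq_of_star hstar ha ha' hb hb' hab)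
    r _ (by simp [hr2]) hβp hβq
  rw [← hβdef, hβ, if_pos] at this
  swap
  · exact ⟨2, rfl⟩
  conv_rhs => rw [← this]
  rw [mul_g_swap_cancel]

end alphaBeta

/-! ### The presentation with four additional relations -/

section presentation

open Equiv MulOpposite

lemma unop_mul_apply {n : ℕ} (f h : FullTransf n) (x : Fin n) :
    (f * h).unop x = h.unop (f.unop x) := rfl

lemma symInclusion_unop_apply {n : ℕ} (σ : SymGroup n) (x : Fin n) :
    (symInclusion n σ).unop x = σ.unop x := rfl

/-- A map from the set of points to itself, as a transformation. -/
def transfOf {n : ℕ} (t : Fin n → Fin n) : FullTransf n := op t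

lemma zetaTransf_unop_apply {n : ℕ} (x : Fin n) :
    (zetaTransf n).unop x = if x.val = 1 then ⟨0, x.pos⟩ else x := rfl

lemma fullTransf_ext {n : ℕ} {f h : FullTransf n} (H : ∀ x, f.unop x = h.unop x) : f = h :=
  unop_injective (funext H)

lemma mem_mrange_symInclusion {n : ℕ} {f : FullTransf n} :
    f ∈ MonoidHom.mrange (symInclusion n) ↔ Function.Injective (f.unop : Fin n → Fin n) := by
  constructor
  · rintro ⟨σ, rfl⟩
    exact σ.unop.injective
  · intro h
    exact ⟨op (Equiv.ofBijective _ (Finite.injective_iff_bijective.1 h)), rfl⟩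

/-- Every transformation is a product of permutations and copies of `zetaTransf n`: a
transformation that is not injective factors through a collapse, with a cofactor of larger
image. -/
lemma mem_of_symInclusion_of_zetaTransf {n : ℕ} (hn : 2 ≤ n) (K : Submonoid (FullTransf n))
    (hK : ∀ σ, symInclusion n σ ∈ K) (hζ : zetaTransf n ∈ K) (f : FullTransf n) : f ∈ K := by
  obtain ⟨k, hk⟩ : ∃ k, ((Set.range (f.unop : Fin n → Fin n))ᶜ).ncard = k := ⟨_, rfl⟩
  induction k using Nat.strong_induction_on generalizing f with
  | _ k ih =>
    by_cases hf : f ∈ MonoidHom.mrange (symInclusion n)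
    · obtain ⟨σ, rfl⟩ := hf
      exact hK σ
    have hinj := mt mem_mrange_symInclusion.2 hf
    obtain ⟨z, hz⟩ : ∃ z, z ∉ Set.range (f.unop : Fin n → Fin n) := by
      by_contra! h
      exact hinj (Finite.injective_iff_surjective.2 h)
    simp only [Function.Injective, not_forall] at hinj
    obtain ⟨x, y, hxy, hne⟩ := hinj
    obtain ⟨σ, hσ⟩ := exists_perm_apply_eq ![(⟨0, by omega⟩ : Fin n), ⟨1, by omega⟩] ![x, y]
      (by simp) (by simpa using hne)
    have h0 : σ ⟨0, by omega⟩ = x := hσ 0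
    have h1 : σ ⟨1, by omega⟩ = y := hσ 1
    obtain ⟨f', hf'y, hf'⟩ : ∃ f' : FullTransf n, f'.unop y = z ∧
        ∀ v, v ≠ y → f'.unop v = f.unop v :=
      ⟨transfOf fun v => if v = y then z else f.unop v, if_pos rfl, fun v hv => if_neg hv⟩
    have hsplit : f = symInclusion n (op σ⁻¹) * zetaTransf n * symInclusion n (op σ) * f' := by
      refine fullTransf_ext fun v => ?_
      simp only [unop_mul_apply, symInclusion_unop_apply, zetaTransf_unop_apply, unop_op]
      have hv : (σ⁻¹ v).val = 1 ↔ v = y := by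
        rw [← h1, ← Perm.inv_eq_iff_eq, Fin.ext_iff]
      by_cases hvy : v = y
      · rw [if_pos (hv.2 hvy), h0, hf' x hne, hvy, hxy]
      · rw [if_neg (mt hv.1 hvy), show σ (σ⁻¹ v) = v from σ.apply_symm_apply v, hf' v hvy]
    rw [hsplit]
    refine K.mul_mem (K.mul_mem (K.mul_mem (hK _) hζ) (hK _)) (ih _ ?_ _ rfl)
    rw [← hk]
    refine Set.ncard_lt_ncard ?_ (Set.toFinite _)
    refine compl_lt_compl_iff_lt.2 ((Set.ssubset_iff_of_subset ?_).2 ⟨z, ⟨y, hf'y⟩, hz⟩)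
    rintro _ ⟨v, rfl⟩
    by_cases hvy : v = y
    · exact ⟨x, by rw [hf' x hne, hvy, hxy]⟩
    · exact ⟨v, hf' v hvy⟩

variable {A : Type*} {n : ℕ}

lemma extendByZeta_map (φ : FreeMonoid A →* SymGroup n) (u : FreeMonoid A) :
    extendByZeta φ (FreeMonoid.map Sum.inl u) = symInclusion n (φ u) := by
  have : (extendByZeta φ).comp (FreeMonoid.map Sum.inl) = (symInclusion n).comp φ := by
    ext a
    simp [extendByZeta]
  exact DFunLike.congr_fun this u

lemma extendByZeta_zeta (φ : FreeMonoid A →* SymGroup n) :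
    extendByZeta φ (FreeMonoid.of (Sum.inr ())) = zetaTransf n := by
  simp [extendByZeta]

lemma alphaPerm_fixes (hn : 7 ≤ n) {x : Fin n} (hx : x.val < 2) : alphaPerm n hn x = x := by
  unfold alphaPerm
  split_ifs
  · apply swap_apply_of_ne_of_ne <;> rw [Fin.ne_iff_vne] <;> simp [pt] <;> omega
  · exact tailCycle_apply_of_lt hx

lemma betaPerm_fixes (hn : 7 ≤ n) {x : Fin n} (hx : x.val < 2) : betaPerm n hn x = x := by
  unfold betaPerm
  split_ifs
  · exact tailCycle_apply_of_lt hx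
  · refine List.formPerm_apply_of_notMem ?_
    simp [pt, Fin.ext_iff]
    omega

lemma zetaTransf_conj {σ : Perm (Fin n)} (hσ : ∀ x : Fin n, x.val < 2 → σ x = x) :
    symInclusion n (op σ⁻¹) * zetaTransf n * symInclusion n (op σ) = zetaTransf n := by
  refine fullTransf_ext fun x => ?_
  simp only [unop_mul_apply, symInclusion_unop_apply, zetaTransf_unop_apply, unop_op]
  have hx : (σ⁻¹ x).val = 1 ↔ x.val = 1 := by
    constructor
    · intro h
      have := hσ (σ⁻¹ x) (by omega)
      rw [show σ (σ⁻¹ x) = x from σ.apply_symm_apply x] at this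
      rw [this, h]
    · intro h
      rw [Perm.inv_eq_iff_eq.2 (hσ x (by omega)).symm, h]
  simp only [hx]
  split_ifs
  · exact hσ _ (by simp)
  · exact σ.apply_symm_apply x

lemma extendByZeta_extraRelations (hn : 7 ≤ n) (φ : FreeMonoid A →* SymGroup n)
    (w : Perm (Fin n) → FreeMonoid A) (hw : ∀ σ, φ (w σ) = op σ)
    {r : FreeMonoid (A ⊕ Unit) × FreeMonoid (A ⊕ Unit)} (hr : r ∈ extraRelations n hn w) :
    extendByZeta φ r.1 = extendByZeta φ r.2 := by
  simp only [extraRelations, Set.mem_insert_iff, Set.mem_singleton_iff] at hr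
  have habs : zetaTransf n = zetaTransf n * symInclusion n (op (swap (pt n 1) (pt n 3))) *
      zetaTransf n * symInclusion n (op (swap (pt n 1) (pt n 3))) := by
    refine fullTransf_ext fun x => ?_
    simp only [unop_mul_apply, symInclusion_unop_apply, zetaTransf_unop_apply, unop_op,
      swap_apply_def, pt, Fin.ext_iff]
    grind
  rcases hr with rfl | rfl | rfl | rfl <;>
    simp only [map_mul, extendByZeta_map, extendByZeta_zeta, hw]
  · refine fullTransf_ext fun x => ?_
    simp only [unop_mul_apply, symInclusion_unop_apply, zetaTransf_unop_apply, unop_op,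
      Perm.mul_apply, swap_apply_def, pt, Fin.ext_iff]
    grind
  · refine fullTransf_ext fun x => ?_
    simp only [unop_mul_apply, symInclusion_unop_apply, zetaTransf_unop_apply, unop_op,
      swap_apply_def, pt, Fin.ext_iff]
    grind
  · rw [zetaTransf_conj fun x => alphaPerm_fixes hn]
    exact habs
  · rw [zetaTransf_conj fun x => betaPerm_fixes hn, mul_assoc, mul_assoc, mul_assoc,
      ← mul_assoc (zetaTransf n), ← mul_assoc (zetaTransf n * _), ← habs]
    refine fullTransf_ext fun x => ?_
    simp only [unop_mul_apply, symInclusion_unop_apply, zetaTransf_unop_apply, unop_op,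
      swap_apply_def, pt, Fin.ext_iff]
    grind

/-- In a monoid with a homomorphism `g` from the symmetric group and an element `e` satisfying the
four additional relations, read from right to left, the conjugates of `e` are a collapse system. -/
lemma exists_collapseSystem {n : ℕ} (hn : 7 ≤ n) {N : Type*} [Monoid N] {g : Perm (Fin n) →* N}
    {e : N}
    (hdisj : e * g (swap (pt n 1) (pt n n) * swap (pt n 2) (pt n 3)) * e *
        g (swap (pt n 1) (pt n n) * swap (pt n 2) (pt n 3)) =
      g (swap (pt n 1) (pt n n) * swap (pt n 2) (pt n 3)) * e *
        g (swap (pt n 1) (pt n n) * swap (pt n 2) (pt n 3)) * e)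
    (hbraid : g (swap (pt n 2) (pt n 3)) * e * g (swap (pt n 2) (pt n 3)) * e *
        g (swap (pt n 2) (pt n 3)) * e * g (swap (pt n 2) (pt n 3)) =
      e * g (swap (pt n 2) (pt n 3)) * e)
    (hα : conjBy g (alphaPerm n hn) e = conjBy g (swap (pt n 1) (pt n 3)) e * e)
    (hβ : conjBy g (betaPerm n hn) e =
      conjBy g (swap (pt n 1) (pt n 3)) e * e * g (swap (pt n 1) (pt n 2))) :
    ∃ E, CollapseSystem g E ∧ E (pt n 1) (pt n 2) = e := by
  have hstar : (∀ a, a ≠ pt n 1 → a ≠ pt n 2 → a ≠ pt n 3 →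
      conjBy g (swap (pt n 3) a) e = e * g (swap (pt n 1) (pt n 2))) ∧
      conjBy g (swap (pt n 1) (pt n 3)) e * e = e * g (swap (pt n 1) (pt n 2)) := by
    rcases Nat.even_or_odd n with h | h
    · have h7 : n ≠ 7 := by rintro rfl; exact absurd h (by decide)
      have h' := Nat.not_odd_iff_even.2 h
      rw [alphaPerm, if_neg h'] at hα
      rw [betaPerm, if_neg h'] at hβ
      exact star_of_relations_even (by omega) h rfl rfl rfl hα hβ
    · rw [alphaPerm, if_pos h] at hα
      rw [betaPerm, if_pos h] at hβ
      exact star_of_relations_odd hn h rfl rfl rfl hα hβ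
  have hswap := fun a b h1 h2 h3 h4 => conjBy_swap_eq_of_star (a := a) (b := b) hstar.1 h1 h2 h3 h4
  have he : e * g (swap (pt n 1) (pt n 2)) = e :=
    mul_swap_eq_self (x := pt n 4) (y := pt n 5) (z := pt n 6) (by simp [pt]) hswap hstar.2
  rw [he] at hstar
  simp only [he] at hswap
  have hfix := conjBy_eq_self_of_swap hswap
  refine ⟨orbitCollapse g e (pt n 1) (pt n 2), collapseSystem_orbitCollapse (r := pt n 3)
    (x := pt n n) ?_ ?_ ?_ ?_ ?_ ?_ hfix he hstar.2 hdisj hbraid, ?_⟩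
  iterate 6 (rw [Fin.ne_iff_vne]; simp [pt]; try omega)
  have := orbitCollapse_apply hfix 1
  rwa [conjBy_one] at this

/-- A homomorphism on the words over `A ∪ {ζ}` that respects the relations identifies any two words
that represent the same transformation, as their common value is determined by the normal form
of that transformation. -/
lemma eq_of_extendByZeta_eq (hn : 7 ≤ n) {R : Set (FreeMonoid A × FreeMonoid A)}
    {φ : FreeMonoid A →* SymGroup n} (hφ : IsMonoidPresentation R φ)
    {w : Perm (Fin n) → FreeMonoid A} (hw : ∀ σ, φ (w σ) = op σ) {N : Type*} [Monoid N]
    (F : FreeMonoid (A ⊕ Unit) →* N)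
    (hF : ∀ r ∈ liftRelations Unit R ∪ extraRelations n hn w, F r.1 = F r.2)
    {u v : FreeMonoid (A ⊕ Unit)} (huv : extendByZeta φ u = extendByZeta φ v) : F u = F v := by
  have hker : ∀ u v : FreeMonoid A, φ u = φ v →
      F (FreeMonoid.map Sum.inl u) = F (FreeMonoid.map Sum.inl v) := by
    have hle : Con.ker φ ≤ Con.ker (F.comp (FreeMonoid.map Sum.inl)) := by
      rw [hφ.2, Con.conGen_le]
      exact fun u v huv => hF _ (Or.inl ⟨(u, v), huv, rfl⟩)
    exact fun u v huv => hle (Con.ker_rel φ |>.2 huv)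
  -- Words act on normal forms on the left in the opposite monoid.
  let g : Perm (Fin n) →* Nᵐᵒᵖ :=
    { toFun := fun σ => op (F (FreeMonoid.map Sum.inl (w σ)))
      map_one' := by
        rw [hker (w 1) 1 (by rw [hw, map_one]; rfl), map_one, map_one, op_one]
      map_mul' := fun σ τ => by
        rw [hker (w (σ * τ)) (w τ * w σ) (by rw [map_mul, hw, hw, hw]; rfl), map_mul, map_mul,
          op_mul] }
  have hg : ∀ σ, g σ = op (F (FreeMonoid.map Sum.inl (w σ))) := fun σ => rfl
  have hgu : ∀ u : FreeMonoid A, op (F (FreeMonoid.map Sum.inl u)) = g (φ u).unop := fun u => by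
    rw [hg, hker u (w (φ u).unop) (by rw [hw, op_unop])]
  let e : Nᵐᵒᵖ := op (F (FreeMonoid.of (Sum.inr ())))
  have he : e = op (F (FreeMonoid.of (Sum.inr ()))) := rfl
  obtain ⟨E, S, hE⟩ : ∃ E, CollapseSystem g E ∧ E (pt n 1) (pt n 2) = e := by
    have hx := fun r hr => congrArg op (hF r (Or.inr hr))
    simp only [extraRelations, Set.mem_insert_iff, Set.mem_singleton_iff, forall_eq_or_imp,
      forall_eq, map_mul F, op_mul, ← hg, ← he, ← mul_assoc] at hx
    refine exists_collapseSystem hn hx.1 hx.2.1 ?_ ?_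
    · rw [conjBy_apply, conjBy_swap]
      exact hx.2.2.1
    · rw [conjBy_apply, conjBy_swap]
      exact hx.2.2.2
  have hpq : pt n 1 ≠ pt n 2 := by simp [pt]
  have key : ∀ (u : FreeMonoid (A ⊕ Unit)) (t : Fin n → Fin n) (m : Nᵐᵒᵖ), S.Represents t m →
      S.Represents (fun x => (extendByZeta φ u).unop (t x)) (op (F u) * m) := by
    intro u
    induction u using FreeMonoid.recOn with
    | one =>
      intro t m h
      rw [map_one, map_one, op_one, one_mul]
      exact h
    | of_mul a u ih =>
      intro t m h
      rw [map_mul, map_mul, op_mul, mul_assoc]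
      refine ih (fun x => (extendByZeta φ (FreeMonoid.of a)).unop (t x)) _ ?_
      rcases a with a | ⟨⟩
      · have h1 := extendByZeta_map φ (FreeMonoid.of a)
        have h2 := hgu (FreeMonoid.of a)
        rw [FreeMonoid.map_of] at h1 h2
        rw [h1, h2]
        exact h.perm_mul _
      · rw [extendByZeta_zeta, ← he, ← hE]
        convert h.collapse_mul hpq using 2 with x
        rw [zetaTransf_unop_apply]
        simp [Fin.ext_iff, pt]
  have hu := key u id 1 S.represents_one
  have hv := key v id 1 S.represents_one
  rw [huv] at hu
  have := hu.unique hv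
  rwa [mul_one, mul_one, op_inj] at this

theorem isMonoidPresentation_extendByZeta (hn : 7 ≤ n) {R : Set (FreeMonoid A × FreeMonoid A)}
    {φ : FreeMonoid A →* SymGroup n} (hφ : IsMonoidPresentation R φ)
    {w : Perm (Fin n) → FreeMonoid A} (hw : ∀ σ, φ (w σ) = op σ) :
    IsMonoidPresentation (liftRelations Unit R ∪ extraRelations n hn w) (extendByZeta φ) := by
  refine ⟨fun f => ?_, le_antisymm ?_ ?_⟩
  · refine mem_of_symInclusion_of_zetaTransf (by omega) (MonoidHom.mrange (extendByZeta φ))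
      (fun σ => ?_) ⟨_, extendByZeta_zeta φ⟩ f
    obtain ⟨u, rfl⟩ := hφ.1 σ
    exact ⟨_, extendByZeta_map φ u⟩
  · intro u v huv
    refine (Con.eq _).1 (eq_of_extendByZeta_eq hn hφ hw (Con.mk' (conGen _)) (fun r hr => ?_)
      ((Con.ker_rel _).1 huv))
    exact (Con.eq _).2 (ConGen.Rel.of _ _ hr)
  · rw [Con.conGen_le]
    rintro u v (⟨⟨u', v'⟩, hr, h⟩ | hr)
    · obtain ⟨rfl, rfl⟩ := Prod.mk.inj h
      rw [Con.ker_rel, extendByZeta_map, extendByZeta_map]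
      have : Con.ker φ u' v' := by
        rw [hφ.2]
        exact ConGen.Rel.of _ _ hr
      rw [(Con.ker_rel φ).1 this]
    · exact extendByZeta_extraRelations hn φ w hw hr

end presentation

/-! ### Lower bounds on the number of relations -/

section lowerBound

open Equiv MulOpposite

variable {n : ℕ}

lemma transfRank_symInclusion (σ : SymGroup n) : transfRank (symInclusion n σ) = n := by
  have : Set.range ((symInclusion n σ).unop : Fin n → Fin n) = Set.univ :=
    σ.unop.surjective.range_eq
  rw [transfRank, this, Set.ncard_univ, Nat.card_fin]

lemma transfRank_le (f : FullTransf n) : transfRank f ≤ n := by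
  have := Set.ncard_le_card (Set.range (f.unop : Fin n → Fin n))
  rwa [Nat.card_fin] at this

lemma injective_iff_transfRank {f : FullTransf n} :
    Function.Injective (f.unop : Fin n → Fin n) ↔ transfRank f = n := by
  constructor
  · intro h
    obtain ⟨σ, rfl⟩ := mem_mrange_symInclusion.2 h
    exact transfRank_symInclusion σ
  · intro h
    refine Finite.injective_iff_surjective.2 (Set.range_eq_univ.1 ?_)
    refine Set.eq_of_subset_of_ncard_le (Set.subset_univ _) ?_ (Set.toFinite _)
    rw [Set.ncard_univ, Nat.card_fin]
    exact h.ge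

lemma transfRank_mul_le_right (f h : FullTransf n) : transfRank (f * h) ≤ transfRank h :=
  Set.ncard_le_ncard (by rintro _ ⟨x, rfl⟩; exact ⟨f.unop x, rfl⟩) (Set.toFinite _)

lemma transfRank_mul_le_left (f h : FullTransf n) : transfRank (f * h) ≤ transfRank f := by
  have : Set.range ((f * h).unop : Fin n → Fin n) =
      (h.unop : Fin n → Fin n) '' Set.range (f.unop : Fin n → Fin n) :=
    Set.range_comp (h.unop : Fin n → Fin n) (f.unop : Fin n → Fin n)
  rw [transfRank, this]
  exact Set.ncard_image_le (Set.toFinite _)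

lemma transfRank_symInclusion_mul (σ : SymGroup n) (f : FullTransf n) :
    transfRank (symInclusion n σ * f) = transfRank f := by
  refine le_antisymm (transfRank_mul_le_right _ _) ?_
  have := transfRank_mul_le_right (symInclusion n σ⁻¹) (symInclusion n σ * f)
  rwa [← mul_assoc, ← map_mul, inv_mul_cancel, map_one, one_mul] at this

/-- If a product has the same rank as its first factor, then it has the same kernel. -/
lemma ker_eq_of_transfRank_le {f h : FullTransf n} (hr : transfRank f ≤ transfRank (f * h))
    (x y : Fin n) : (f * h).unop x = (f * h).unop y ↔ f.unop x = f.unop y := by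
  refine ⟨fun hxy => ?_, fun hxy => congrArg (h.unop : Fin n → Fin n) hxy⟩
  have himg : Set.range ((f * h).unop : Fin n → Fin n) =
      (h.unop : Fin n → Fin n) '' Set.range (f.unop : Fin n → Fin n) :=
    Set.range_comp (h.unop : Fin n → Fin n) (f.unop : Fin n → Fin n)
  have hinj := Set.injOn_of_ncard_image_eq (s := Set.range (f.unop : Fin n → Fin n))
    (f := (h.unop : Fin n → Fin n))
    (le_antisymm (Set.ncard_image_le (Set.toFinite _)) (by rw [← himg]; exact hr))
  exact hinj ⟨x, rfl⟩ ⟨y, rfl⟩ hxy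

variable {X : Type*}

lemma eq_of_mem_presentation {M : Type*} [Monoid M] {Q : Set (FreeMonoid X × FreeMonoid X)}
    {ψ : FreeMonoid X →* M} (hQ : IsMonoidPresentation Q ψ) {r : FreeMonoid X × FreeMonoid X}
    (hr : r ∈ Q) : ψ r.1 = ψ r.2 := by
  rw [← Con.ker_rel, hQ.2]
  exact ConGen.Rel.of _ _ hr

/-- To show that a function `I` of words takes equal values on words that represent the same
element satisfying `P`, it suffices to consider the application of one relation inside a
word. -/
lemma invariant_of_presentation {M V : Type*} [Monoid M] {Q : Set (FreeMonoid X × FreeMonoid X)}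
    {ψ : FreeMonoid X →* M} (hQ : IsMonoidPresentation Q ψ) (P : M → Prop) (I : FreeMonoid X → V)
    (hI : ∀ r ∈ Q, ψ r.1 = ψ r.2 → ∀ x y, P (ψ (x * r.1 * y)) → I (x * r.1 * y) = I (x * r.2 * y))
    {u v : FreeMonoid X} (huv : ψ u = ψ v) (hu : P (ψ u)) : I u = I v := by
  let c : Con (FreeMonoid X) :=
    { r := fun u v => ψ u = ψ v ∧ ∀ x y, P (ψ (x * u * y)) → I (x * u * y) = I (x * v * y)
      iseqv :=
        { refl := fun u => ⟨rfl, fun _ _ _ => rfl⟩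
          symm := fun {u v} h => ⟨h.1.symm, fun x y hP => (h.2 x y (by
            simpa only [map_mul, h.1] using hP)).symm⟩
          trans := fun {u v w} h h' => ⟨h.1.trans h'.1, fun x y hP => (h.2 x y hP).trans
            (h'.2 x y (by simpa only [map_mul, h.1] using hP))⟩ }
      mul' := fun {u u' v v'} h h' => ⟨by rw [map_mul, map_mul, h.1, h'.1], fun x y hP => by
        have h1 := h.2 x (v * y) (by simpa only [mul_assoc] using hP)
        have h2 := h'.2 (x * u') y (by simpa only [map_mul, h.1, mul_assoc] using hP)
        simp only [mul_assoc] at h1 h2 ⊢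
        exact h1.trans h2⟩ }
  have hle : Con.ker ψ ≤ c := by
    rw [hQ.2, Con.conGen_le]
    intro u v huv
    have hψ : ψ u = ψ v := eq_of_mem_presentation hQ huv
    exact ⟨hψ, hI _ huv hψ⟩
  have := (hle ((Con.ker_rel ψ).2 huv)).2 1 1
  simpa only [one_mul, mul_one, hu, true_implies] using this

/-! #### Relations of rank `n - 2` -/

/-- The kernel of the transformation represented by the first prefix of a word that does not
represent a permutation. It is encoded as the intersection of the kernels of all such prefixes,
which increase with the prefix. -/
def firstKernel (ψ : FreeMonoid X →* FullTransf n) (u : FreeMonoid X) : Set (Fin n × Fin n) :=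
  {ij | ∀ p q, u = p * q → ¬ Function.Injective ((ψ p).unop : Fin n → Fin n) →
    (ψ p).unop ij.1 = (ψ p).unop ij.2}

lemma prefix_cases {p q p' q' : FreeMonoid X} (h : p * q = p' * q') :
    (∃ a, p' = p * a ∧ q = a * q') ∨ (∃ a, p = p' * a ∧ q' = a * q) := by
  exact List.append_eq_append_iff.1 h

lemma injective_of_mul {f h : FullTransf n}
    (hfh : Function.Injective ((f * h).unop : Fin n → Fin n)) :
    Function.Injective (f.unop : Fin n → Fin n) :=
  Function.Injective.of_comp (f := (h.unop : Fin n → Fin n)) hfh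

lemma firstKernel_mul (ψ : FreeMonoid X →* FullTransf n) {p : FreeMonoid X} (q : FreeMonoid X)
    (hp : ¬ Function.Injective ((ψ p).unop : Fin n → Fin n)) :
    firstKernel ψ (p * q) = firstKernel ψ p := by
  ext ⟨i, j⟩
  constructor
  · rintro h p' q' rfl hp'
    exact h p' (q' * q) (mul_assoc _ _ _) hp'
  · intro h p' q' hpq hp'
    rcases prefix_cases hpq with ⟨a, rfl, _⟩ | ⟨a, rfl, _⟩
    · have := h p 1 (mul_one p).symm hp
      simp only [map_mul, unop_mul_apply] at this ⊢
      rw [this]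
    · exact h p' a rfl hp'

lemma firstKernel_mul_of_injective (ψ : FreeMonoid X →* FullTransf n) {p p' : FreeMonoid X}
    (q : FreeMonoid X) (hp : Function.Injective ((ψ p).unop : Fin n → Fin n)) (h : ψ p = ψ p') :
    firstKernel ψ (p * q) ⊆ firstKernel ψ (p' * q) := by
  rintro ⟨i, j⟩ hij a b hab ha
  rcases prefix_cases hab with ⟨c, rfl, rfl⟩ | ⟨c, rfl, rfl⟩
  · have := hij (p * c) b (mul_assoc _ _ _).symm
    simp only [map_mul, h] at this ha ⊢
    exact this ha
  · rw [h, map_mul] at hp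
    exact absurd (injective_of_mul hp) ha

/-- A word representing a transformation of rank `n - 1` has the kernel of that transformation as
its first kernel, because the kernels of smaller transformations are trivial. -/
lemma firstKernel_of_transfRank (hn : 1 ≤ n) (ψ : FreeMonoid X →* FullTransf n)
    {p : FreeMonoid X} (hp : transfRank (ψ p) = n - 1) :
    firstKernel ψ p = {ij | (ψ p).unop ij.1 = (ψ p).unop ij.2} := by
  ext ⟨i, j⟩
  constructor
  · intro h
    refine h p 1 (mul_one p).symm ?_
    rw [injective_iff_transfRank]
    omega
  · rintro h a b rfl ha
    rw [injective_iff_transfRank] at ha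
    have := transfRank_le (ψ a)
    rw [map_mul] at hp
    refine (ker_eq_of_transfRank_le (f := ψ a) (h := ψ b) (by omega) i j).1 ?_
    rw [← map_mul]
    exact h

/-- Let `T` be a property of transformations that depends on the kernel only, up to permutations
of the points. If two transformations of rank `n - 1` with different kernels commute and their
product has rank `n - 2` and the property `T`, then every presentation contains a relation with
these two properties: the other relations preserve the first kernels of words representing
transformations of rank `n - 2` with property `T`. -/
lemma exists_relation_of_commute (hn : 4 ≤ n) {Q : Set (FreeMonoid X × FreeMonoid X)}
    {ψ : FreeMonoid X →* FullTransf n} (hQ : IsMonoidPresentation Q ψ)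
    (T : FullTransf n → Prop)
    (hker : ∀ f h : FullTransf n, (∀ x y, f.unop x = f.unop y ↔ h.unop x = h.unop y) → T f → T h)
    (hperm : ∀ (σ : Perm (Fin n)) (f : FullTransf n), T (symInclusion n (op σ) * f) → T f)
    {e f : FullTransf n} (he : transfRank e = n - 1) (hf : transfRank f = n - 1)
    (hef : e * f = f * e) (hr : transfRank (e * f) = n - 2) (hT : T (e * f)) {i j : Fin n}
    (hei : e.unop i = e.unop j) (hfi : f.unop i ≠ f.unop j) :
    ∃ r ∈ Q, transfRank (ψ r.1) = n - 2 ∧ T (ψ r.1) := by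
  by_contra! hno
  obtain ⟨u, rfl⟩ := hQ.1 e
  obtain ⟨v, rfl⟩ := hQ.1 f
  have hinv : firstKernel ψ (u * v) = firstKernel ψ (v * u) := by
    refine invariant_of_presentation hQ (fun h => transfRank h = n - 2 ∧ T h) (firstKernel ψ) ?_
      (by rw [map_mul, map_mul, hef]) (by rw [map_mul]; exact ⟨hr, hT⟩)
    rintro ⟨a, b⟩ hab hψ x y ⟨hrank, hTxy⟩
    dsimp only at hψ hrank hTxy ⊢
    have hψ' : ψ (x * a) = ψ (x * b) := by rw [map_mul, map_mul, hψ]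
    by_cases hx : Function.Injective ((ψ x).unop : Fin n → Fin n)
    swap
    · rw [mul_assoc, mul_assoc, firstKernel_mul _ _ hx, firstKernel_mul _ _ hx]
    by_cases ha : Function.Injective ((ψ (x * a)).unop : Fin n → Fin n)
    · exact Set.Subset.antisymm (firstKernel_mul_of_injective ψ y ha hψ')
        (firstKernel_mul_of_injective ψ y (hψ' ▸ ha) hψ'.symm)
    · have hb : ¬ Function.Injective ((ψ (x * b)).unop : Fin n → Fin n) := by rwa [← hψ']
      rw [firstKernel_mul ψ (p := x * a) y ha, firstKernel_mul ψ (p := x * b) y hb]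
      rw [injective_iff_transfRank] at ha
      have h1 := transfRank_le (ψ (x * a))
      rw [map_mul] at hrank hTxy
      have h2 := transfRank_mul_le_left (ψ (x * a)) (ψ y)
      have h3 : transfRank (ψ (x * a)) ≠ n - 2 := by
        intro h3
        have hTa : T (ψ (x * a)) :=
          hker _ _ (ker_eq_of_transfRank_le (by omega)) hTxy
        obtain ⟨σ, hσ⟩ := mem_mrange_symInclusion.2 hx
        rw [map_mul, ← hσ] at hTa
        refine hno (a, b) hab ?_ (hperm σ.unop _ hTa)
        rw [← transfRank_symInclusion_mul σ, hσ, ← map_mul, h3]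
      rw [firstKernel_of_transfRank (by omega) ψ (p := x * a) (by omega),
        firstKernel_of_transfRank (by omega) ψ (p := x * b) (by rw [← hψ']; omega), hψ']
  rw [firstKernel_mul, firstKernel_mul, firstKernel_of_transfRank (by omega) ψ he,
    firstKernel_of_transfRank (by omega) ψ hf] at hinv
  · exact hfi (hinv ▸ hei : (i, j) ∈ {ij : Fin n × Fin n | (ψ v).unop ij.1 = (ψ v).unop ij.2})
  · rw [injective_iff_transfRank]; omega
  · rw [injective_iff_transfRank]; omega

lemma transfRank_of_range {f : FullTransf n} {s : Set (Fin n)}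
    (h : ∀ x, (∃ y, f.unop y = x) ↔ x ∉ s) : transfRank f = n - s.ncard := by
  have : Set.range (f.unop : Fin n → Fin n) = sᶜ := Set.ext h
  rw [transfRank, this, Set.ncard_compl s (Set.toFinite s), Nat.card_fin]

/-- The transformation that maps `j` to `i` and fixes every other point. -/
def collapseTransf (i j : Fin n) : FullTransf n := transfOf fun x => if x = j then i else x

lemma collapseTransf_unop_apply (i j x : Fin n) :
    (collapseTransf i j).unop x = if x = j then i else x := rfl

lemma transfRank_collapseTransf {i j : Fin n} (h : i ≠ j) :
    transfRank (collapseTransf i j) = n - 1 := by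
  rw [transfRank_of_range (s := {j}), Set.ncard_singleton]
  intro x
  simp only [collapseTransf_unop_apply, Set.mem_singleton_iff]
  exact ⟨by grind, fun hx => ⟨x, if_neg hx⟩⟩

lemma transfRank_collapseTransf_mul {i j k l : Fin n} (hij : i ≠ j) (hil : i ≠ l) (hkl : k ≠ l)
    (hjl : j ≠ l) (hjk : j ≠ k) :
    transfRank (collapseTransf i j * collapseTransf k l) = n - 2 := by
  rw [transfRank_of_range (s := {j, l}), Set.ncard_pair hjl]
  intro x
  simp only [unop_mul_apply, collapseTransf_unop_apply, Set.mem_insert_iff,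
    Set.mem_singleton_iff, not_or]
  exact ⟨by grind, fun hx => ⟨x, by rw [if_neg hx.1, if_neg hx.2]⟩⟩

/-- Three points have the same image. -/
def CollapsesTriple (f : FullTransf n) : Prop :=
  ∃ a b c, a ≠ b ∧ a ≠ c ∧ b ≠ c ∧ f.unop a = f.unop b ∧ f.unop a = f.unop c

lemma CollapsesTriple.of_ker_eq {f h : FullTransf n}
    (hfh : ∀ x y, f.unop x = f.unop y ↔ h.unop x = h.unop y) (hf : CollapsesTriple f) :
    CollapsesTriple h := by
  obtain ⟨a, b, c, hab, hac, hbc, h1, h2⟩ := hf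
  exact ⟨a, b, c, hab, hac, hbc, (hfh _ _).1 h1, (hfh _ _).1 h2⟩

lemma collapsesTriple_symInclusion_mul (σ : SymGroup n) {f : FullTransf n} :
    CollapsesTriple (symInclusion n σ * f) ↔ CollapsesTriple f := by
  have key : ∀ (τ : SymGroup n) (h : FullTransf n),
      CollapsesTriple (symInclusion n τ * h) → CollapsesTriple h := by
    rintro τ h ⟨a, b, c, hab, hac, hbc, h1, h2⟩
    exact ⟨τ.unop a, τ.unop b, τ.unop c, τ.unop.injective.ne hab, τ.unop.injective.ne hac,
      τ.unop.injective.ne hbc, h1, h2⟩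
  refine ⟨key σ f, fun h => key σ⁻¹ _ ?_⟩
  rwa [← mul_assoc, ← map_mul, inv_mul_cancel, map_one, one_mul]

lemma two_le_encard_of_mem_of_mem {α : Type*} {s : Set α} {a b : α} (ha : a ∈ s) (hb : b ∈ s)
    (hab : a ≠ b) : 2 ≤ s.encard := by
  rw [← Set.encard_pair hab]
  exact Set.encard_le_encard (Set.insert_subset ha (Set.singleton_subset_iff.2 hb))

/-- One relation of rank `n - 2` identifies three points, and another one does not. -/
lemma two_le_encard_rank_sub_two (hn : 4 ≤ n) {Q : Set (FreeMonoid X × FreeMonoid X)}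
    {ψ : FreeMonoid X →* FullTransf n} (hQ : IsMonoidPresentation Q ψ) :
    2 ≤ {r ∈ Q | transfRank (ψ r.1) = n - 2}.encard := by
  obtain ⟨p, q, r, s, hpq, hpr, hps, hqr, hqs, hrs⟩ : ∃ p q r s : Fin n,
      p ≠ q ∧ p ≠ r ∧ p ≠ s ∧ q ≠ r ∧ q ≠ s ∧ r ≠ s :=
    ⟨⟨0, by omega⟩, ⟨1, by omega⟩, ⟨2, by omega⟩, ⟨3, by omega⟩, by simp⟩
  obtain ⟨a, haQ, ha, haT⟩ := exists_relation_of_commute hn hQ CollapsesTriple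
    (fun f h => CollapsesTriple.of_ker_eq) (fun σ f => (collapsesTriple_symInclusion_mul _).1)
    (e := collapseTransf p q) (f := collapseTransf p r) (i := p) (j := q)
    (transfRank_collapseTransf hpq) (transfRank_collapseTransf hpr)
    (fullTransf_ext fun x => by simp only [unop_mul_apply, collapseTransf_unop_apply]; grind)
    (transfRank_collapseTransf_mul hpq hpr hpr hqr hpq.symm)
    ⟨p, q, r, hpq, hpr, hqr, by simp only [unop_mul_apply, collapseTransf_unop_apply]; grind,
      by simp only [unop_mul_apply, collapseTransf_unop_apply]; grind⟩
    (by simp only [collapseTransf_unop_apply]; grind)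
    (by simp only [collapseTransf_unop_apply]; grind)
  obtain ⟨b, hbQ, hb, hbT⟩ := exists_relation_of_commute hn hQ (fun f => ¬ CollapsesTriple f)
    (fun f h hfh => mt (CollapsesTriple.of_ker_eq fun x y => (hfh x y).symm))
    (fun σ f => mt (collapsesTriple_symInclusion_mul _).2)
    (e := collapseTransf p q) (f := collapseTransf r s) (i := p) (j := q)
    (transfRank_collapseTransf hpq) (transfRank_collapseTransf hrs)
    (fullTransf_ext fun x => by simp only [unop_mul_apply, collapseTransf_unop_apply]; grind)
    (transfRank_collapseTransf_mul hpq hps hrs hqs hqr)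
    (by
      rintro ⟨a, b, c, hab, hac, hbc, h1, h2⟩
      simp only [unop_mul_apply, collapseTransf_unop_apply] at h1 h2
      grind)
    (by simp only [collapseTransf_unop_apply]; grind)
    (by simp only [collapseTransf_unop_apply]; grind)
  refine two_le_encard_of_mem_of_mem (a := a) (b := b) ⟨haQ, ha⟩ ⟨hbQ, hb⟩ ?_
  rintro rfl
  exact hbT haT

/-! #### Relations of rank `n - 1` -/

lemma symInclusion_injective : Function.Injective (symInclusion n) := fun _ _ h =>
  unop_injective (Equiv.ext fun x => congrFun (congrArg unop h) x)

open Classical in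
/-- The product of the signs of the letters of a word that represent permutations, together with
the number of the other letters. -/
noncomputable def signCount (ψ : FreeMonoid X →* FullTransf n) :
    FreeMonoid X →* ℤˣ × Multiplicative ℤ :=
  FreeMonoid.lift fun a =>
    if h : ∃ σ, symInclusion n σ = ψ (FreeMonoid.of a) then (Perm.sign h.choose.unop, 1)
    else (1, Multiplicative.ofAdd 1)

lemma signCount_of_perm {ψ : FreeMonoid X →* FullTransf n} {a : X} {σ : SymGroup n}
    (h : symInclusion n σ = ψ (FreeMonoid.of a)) :
    signCount ψ (FreeMonoid.of a) = (Perm.sign σ.unop, 1) := by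
  have hex : ∃ σ, symInclusion n σ = ψ (FreeMonoid.of a) := ⟨σ, h⟩
  rw [signCount, FreeMonoid.lift_eval_of, dif_pos hex,
    symInclusion_injective (hex.choose_spec.trans h.symm)]

lemma signCount_of_not_perm {ψ : FreeMonoid X →* FullTransf n} {a : X}
    (h : ¬ ∃ σ, symInclusion n σ = ψ (FreeMonoid.of a)) :
    signCount ψ (FreeMonoid.of a) = (1, Multiplicative.ofAdd 1) := by
  rw [signCount, FreeMonoid.lift_eval_of, dif_neg h]

lemma signCount_eq_sign (ψ : FreeMonoid X →* FullTransf n) (u : FreeMonoid X) (σ : SymGroup n)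
    (h : symInclusion n σ = ψ u) : signCount ψ u = (Perm.sign σ.unop, 1) := by
  induction u using FreeMonoid.recOn generalizing σ with
  | one =>
    rw [map_one, ← map_one (symInclusion n)] at h
    rw [symInclusion_injective h, map_one, unop_one, map_one]
    rfl
  | of_mul a u ih =>
    rw [map_mul] at h
    obtain ⟨τ, hτ⟩ : ψ (FreeMonoid.of a) ∈ MonoidHom.mrange (symInclusion n) := by
      refine mem_mrange_symInclusion.2 (injective_of_mul (h := ψ u) ?_)
      rw [← h]
      exact σ.unop.injective
    have hu : symInclusion n (τ⁻¹ * σ) = ψ u := by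
      rw [map_mul, h, ← hτ, ← mul_assoc, ← map_mul, inv_mul_cancel, map_one, one_mul]
    rw [map_mul, signCount_of_perm hτ, ih _ hu, Prod.mk_mul_mk, one_mul, ← map_mul,
      unop_mul, Perm.sign_mul, Perm.sign_mul, unop_inv, Perm.sign_inv]
    rw [mul_left_comm, Int.units_mul_self, mul_one]

lemma signCount_count (ψ : FreeMonoid X →* FullTransf n) (u : FreeMonoid X) :
    0 ≤ (signCount ψ u).2.toAdd ∧
      ((signCount ψ u).2.toAdd = 0 → ∃ σ, symInclusion n σ = ψ u) := by
  induction u using FreeMonoid.recOn with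
  | one => exact ⟨by rw [map_one]; rfl, fun _ => ⟨1, by rw [map_one, map_one]⟩⟩
  | of_mul a u ih =>
    by_cases h : ∃ σ, symInclusion n σ = ψ (FreeMonoid.of a)
    · obtain ⟨σ, hσ⟩ := h
      rw [map_mul, signCount_of_perm hσ, Prod.snd_mul, one_mul]
      refine ⟨ih.1, fun h => ?_⟩
      obtain ⟨τ, hτ⟩ := ih.2 h
      exact ⟨σ * τ, by rw [map_mul, map_mul, hσ, hτ]⟩
    · rw [map_mul, signCount_of_not_perm h, Prod.snd_mul, toAdd_mul, toAdd_ofAdd]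
      exact ⟨by omega, fun h => by omega⟩

/-- If at most one relation had rank `n - 1`, then `signCount`, modulo the powers of a single
element `d`, would be an invariant of the words representing a transformation of rank `n - 1`.
But `e² = e` forces the second component of `d` to be nontrivial, while absorption of the
transposition of the two collapsed points makes `(-1, 1)` a power of `d`. -/
lemma two_le_encard_rank_sub_one (hn : 2 ≤ n) {Q : Set (FreeMonoid X × FreeMonoid X)}
    {ψ : FreeMonoid X →* FullTransf n} (hQ : IsMonoidPresentation Q ψ) :
    2 ≤ {r ∈ Q | transfRank (ψ r.1) = n - 1}.encard := by
  by_contra hlt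
  have hsub : {r ∈ Q | transfRank (ψ r.1) = n - 1}.Subsingleton := fun a ha b hb => by
    by_contra hab
    exact hlt (two_le_encard_of_mem_of_mem ha hb hab)
  obtain ⟨d, hd⟩ : ∃ d, ∀ r ∈ Q, transfRank (ψ r.1) = n - 1 →
      signCount ψ r.1 / signCount ψ r.2 = d := by
    rcases hsub.eq_empty_or_singleton with h | ⟨r, h⟩
    · refine ⟨1, fun r hr hr' => ?_⟩
      have : r ∈ {r ∈ Q | transfRank (ψ r.1) = n - 1} := ⟨hr, hr'⟩
      rw [h] at this
      exact this.elim
    · refine ⟨signCount ψ r.1 / signCount ψ r.2, fun r' hr hr' => ?_⟩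
      have : r' ∈ {r ∈ Q | transfRank (ψ r.1) = n - 1} := ⟨hr, hr'⟩
      rw [h] at this
      rw [this]
  have hinv : ∀ {u v : FreeMonoid X}, ψ u = ψ v → transfRank (ψ u) = n - 1 →
      signCount ψ u / signCount ψ v ∈ Subgroup.zpowers d := by
    intro u v huv hu
    have := invariant_of_presentation hQ (fun f => transfRank f = n - 1)
      ((QuotientGroup.mk' (Subgroup.zpowers d)).comp (signCount ψ)) ?_ huv hu
    · exact QuotientGroup.eq_iff_div_mem.1 this
    intro r hr hψ x y hxy
    suffices h : (QuotientGroup.mk' (Subgroup.zpowers d)).comp (signCount ψ) r.1 =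
        (QuotientGroup.mk' (Subgroup.zpowers d)).comp (signCount ψ) r.2 by
      rw [map_mul, map_mul, h, ← map_mul, ← map_mul]
    refine QuotientGroup.eq_iff_div_mem.2 ?_
    rw [map_mul, map_mul] at hxy
    have h1 := transfRank_mul_le_left (ψ x * ψ r.1) (ψ y)
    have h2 := transfRank_mul_le_right (ψ x) (ψ r.1)
    have h3 := transfRank_le (ψ r.1)
    by_cases hrank : transfRank (ψ r.1) = n
    · obtain ⟨σ, hσ⟩ := mem_mrange_symInclusion.2 (injective_iff_transfRank.2 hrank)
      rw [signCount_eq_sign ψ _ σ hσ, signCount_eq_sign ψ _ σ (hσ.trans hψ), div_self']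
      exact one_mem _
    · rw [hd r hr (by omega)]
      exact Subgroup.mem_zpowers d
  obtain ⟨p, q, hpq⟩ : ∃ p q : Fin n, p ≠ q := ⟨⟨0, by omega⟩, ⟨1, by omega⟩, by simp⟩
  have hrank := transfRank_collapseTransf hpq
  obtain ⟨u, hu⟩ := hQ.1 (collapseTransf p q)
  obtain ⟨s, hs⟩ := hQ.1 (symInclusion n (op (swap p q)))
  have huu : ψ (u * u) = ψ u := by
    rw [map_mul, hu]
    refine fullTransf_ext fun x => ?_
    simp only [unop_mul_apply, collapseTransf_unop_apply]
    grind
  have hsu : ψ (s * u) = ψ u := by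
    rw [map_mul, hu, hs]
    refine fullTransf_ext fun x => ?_
    simp only [unop_mul_apply, collapseTransf_unop_apply, symInclusion_unop_apply, unop_op,
      swap_apply_def]
    grind
  have h1 := hinv huu (by rw [huu, hu, hrank])
  have h2 := hinv hsu (by rw [hsu, hu, hrank])
  rw [map_mul, mul_div_cancel_right] at h1 h2
  rw [signCount_eq_sign ψ s _ hs.symm, unop_op, Perm.sign_swap hpq] at h2
  obtain ⟨m, hm⟩ := Subgroup.mem_zpowers_iff.1 h1
  obtain ⟨k, hk⟩ := Subgroup.mem_zpowers_iff.1 h2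
  have hk1 : d.1 ^ k = -1 := congrArg Prod.fst hk
  have hk2 : k * d.2.toAdd = 0 := congrArg (fun c => c.2.toAdd) hk
  have hm2 : m * d.2.toAdd = (signCount ψ u).2.toAdd := congrArg (fun c => c.2.toAdd) hm
  rcases mul_eq_zero.1 hk2 with h | h
  · rw [h, zpow_zero] at hk1
    exact absurd hk1 (by decide)
  · rw [h, mul_zero] at hm2
    obtain ⟨σ, hσ⟩ := (signCount_count ψ u).2 hm2.symm
    have := transfRank_symInclusion σ
    rw [hσ, hu, hrank] at this
    omega

/-! #### Counting the relations -/

lemma lower_bounds (hn : 4 ≤ n) {Q : Set (FreeMonoid X × FreeMonoid X)}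
    {ψ : FreeMonoid X →* FullTransf n} (hQ : IsMonoidPresentation Q ψ) :
    4 ≤ (nonSymRelations Q ψ).encard ∧
      2 ≤ {r ∈ nonSymRelations Q ψ | transfRank (ψ r.1) = n - 2}.encard := by
  have hnon : ∀ r ∈ Q, transfRank (ψ r.1) ≠ n → r ∈ nonSymRelations Q ψ := by
    refine fun r hr hrank => ⟨hr, ?_⟩
    rwa [mem_mrange_symInclusion, injective_iff_transfRank]
  have h1 := two_le_encard_rank_sub_one (by omega) hQ
  have h2 := two_le_encard_rank_sub_two hn hQ
  constructor
  · have hdisj : Disjoint {r ∈ Q | transfRank (ψ r.1) = n - 1}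
        {r ∈ Q | transfRank (ψ r.1) = n - 2} := by
      rw [Set.disjoint_left]
      rintro r ⟨_, h⟩ ⟨_, h'⟩
      omega
    calc (4 : ℕ∞) = 2 + 2 := by norm_num
      _ ≤ _ := add_le_add h1 h2
      _ = _ := (Set.encard_union_eq hdisj).symm
      _ ≤ _ := Set.encard_le_encard (Set.union_subset
        (fun r hr => hnon r hr.1 (by rw [hr.2]; omega))
        (fun r hr => hnon r hr.1 (by rw [hr.2]; omega)))
  · exact h2.trans (Set.encard_le_encard fun r hr => ⟨hnon r hr.1 (by rw [hr.2]; omega), hr.2⟩)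

/-- If part of the relations presents the symmetric group over part of the letters, then those
relations hold between permutations: the letters represent the elements of a homomorphic image
of a group, hence units. -/
lemma nonSymRelations_subset {A B : Type*} {R : Set (FreeMonoid A × FreeMonoid A)}
    {S : Set (FreeMonoid (A ⊕ B) × FreeMonoid (A ⊕ B))} {φ : FreeMonoid A →* SymGroup n}
    {ψ : FreeMonoid (A ⊕ B) →* FullTransf n} (hφ : IsMonoidPresentation R φ)
    (hψ : IsMonoidPresentation (liftRelations B R ∪ S) ψ) :
    nonSymRelations (liftRelations B R ∪ S) ψ ⊆ S := by
  rintro r ⟨⟨⟨u, v⟩, huv, rfl⟩ | hr, hnot⟩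
  swap
  · exact hr
  refine absurd ?_ hnot
  obtain ⟨v, hv⟩ := hφ.1 (φ u)⁻¹
  have hle : Con.ker φ ≤ Con.ker (ψ.comp (FreeMonoid.map Sum.inl)) := by
    rw [hφ.2, Con.conGen_le]
    exact fun u v h => eq_of_mem_presentation hψ (Or.inl ⟨(u, v), h, rfl⟩)
  have huv : ψ (FreeMonoid.map Sum.inl (u * v)) = 1 := by
    have := hle ((Con.ker_rel φ).2 (show φ (u * v) = φ 1 by
      rw [map_mul, hv, mul_inv_cancel, map_one]))
    rw [Con.ker_rel, MonoidHom.comp_apply, MonoidHom.comp_apply, map_one, map_one] at this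
    exact this
  rw [map_mul, map_mul] at huv
  refine mem_mrange_symInclusion.2 (injective_of_mul (h := ψ (FreeMonoid.map Sum.inl v)) ?_)
  dsimp only
  rw [huv]
  exact Function.injective_id

end lowerBound

theorem theorem1p5 :
    -- the presentation with four additional relations, for every presentation of the
    -- symmetric group and every choice of words representing the permutations
    (∀ (n : ℕ) (hn : 7 ≤ n) (A : Type*) (R : Set (FreeMonoid A × FreeMonoid A))
        (φ : FreeMonoid A →* SymGroup n), IsMonoidPresentation R φ →
        ∀ w : Equiv.Perm (Fin n) → FreeMonoid A, (∀ σ, φ (w σ) = MulOpposite.op σ) →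
          IsMonoidPresentation (liftRelations Unit R ∪ extraRelations n hn w)
            (extendByZeta φ)) ∧
    -- the lower bounds, for every presentation of the full transformation monoid
    (∀ (n : ℕ), 4 ≤ n → ∀ (X : Type*) (Q : Set (FreeMonoid X × FreeMonoid X))
        (ψ : FreeMonoid X →* FullTransf n), IsMonoidPresentation Q ψ →
          4 ≤ (nonSymRelations Q ψ).encard ∧
          2 ≤ {r ∈ nonSymRelations Q ψ | transfRank (ψ r.1) = n - 2}.encard) ∧
    -- the lower bounds, for presentations that extend a presentation of the symmetric group
    (∀ (n : ℕ), 4 ≤ n → ∀ (A B : Type*) (R : Set (FreeMonoid A × FreeMonoid A))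
        (S : Set (FreeMonoid (A ⊕ B) × FreeMonoid (A ⊕ B)))
        (φ : FreeMonoid A →* SymGroup n) (ψ : FreeMonoid (A ⊕ B) →* FullTransf n),
        IsMonoidPresentation R φ → IsMonoidPresentation (liftRelations B R ∪ S) ψ →
          4 ≤ S.encard ∧ 2 ≤ {r ∈ S | transfRank (ψ r.1) = n - 2}.encard) := by
  refine ⟨fun n hn A R φ hφ w hw => isMonoidPresentation_extendByZeta hn hφ hw,
    fun n hn X Q ψ hQ => lower_bounds hn hQ, fun n hn A B R S φ ψ hφ hψ => ?_⟩
  have hsub := nonSymRelations_subset hφ hψ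
  obtain ⟨h1, h2⟩ := lower_bounds hn hψ
  exact ⟨h1.trans (Set.encard_le_encard hsub),
    h2.trans (Set.encard_le_encard fun r hr => ⟨hsub hr.1, hr.2⟩)⟩
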